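/- There are absolute constants $C>0$ and $k\in\mathbb N$ such that for every integer $N\ge 1$ and every $\varepsilon>0$ there is a randomized adaptive algorithm which, given access to conditional sampling oracles for two unknown distributions $\mu,\tau$ over $\Omega=\{1,\dots,N\}$, makes in every execution at most $$C\cdot\left(\frac{\max\{0,\log\log N\}}{\varepsilon^2}+\frac1{\varepsilon^7}\right)\cdot\bigl(1+|\log(1/\varepsilon)|\bigr)^k$$ oracle calls in total (where $\max\{0,\log\log N\}$ is read as $0$ for $N=1$), and, for all distributions $\mu,\tau$ over $\Omega$, outputs with probability at least $2/3$ a real number $r$ with $|r-d_{\mathrm{TV}}(\mu,\tau)|\le\varepsilon$. Here $d_{\mathrm{TV}}(\mu,\tau)=\frac12\sum_{x\in\Omega}|\mu(x)-\tau(x)|$. A conditional sampling oracle for $\mu$ gets a set $A\subseteq\Omega$ and, if $\mu(A)>0$, returns a fresh independent sample from $\mu$ conditioned on $A$; if $\mu(A)=0$, its answer is drawn from an arbitrary distribution depending on $A$ over the elements of $\Omega$ and an error symbol. The same algorithm has to work for every choice of these latter distributions. -/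

import Mathlib

namespace CondSampling

/-- A (possibly adaptive, possibly randomized) algorithm with query access to a family, indexed by
`ι`, of conditional sampling oracles over the domain `Ω`, with outputs in `R`, as a decision tree.
Each internal node either tosses internal coins, or names one of the oracles and a condition set
`A ⊆ Ω`, and continues according to the answer that it gets. -/
inductive Algorithm (ι Ω R : Type) : Type
  /-- Stop and output `r`. -/
  | output (r : R) : Algorithm ι Ω R
  /-- Draw fresh internal randomness from a discrete distribution that is known to the algorithm
  (this uses no oracle call). -/
  | toss (p : PMF ℕ) (next : ℕ → Algorithm ι Ω R) : Algorithm ι Ω R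
  /-- Ask oracle number `i` for a sample conditioned on `A`. The answer is an element of `Ω`, or
  the error symbol `none` (which can only occur if `A` has probability zero). -/
  | query (i : ι) (A : Finset Ω) (next : Option Ω → Algorithm ι Ω R) : Algorithm ι Ω R

/-- `alg.QueriesAtMost q`: along every branch, `alg` makes at most `q` oracle calls (to all the
oracles together). -/
def Algorithm.QueriesAtMost {ι Ω R : Type} : Algorithm ι Ω R → ℕ → Prop
  | .output _, _ => True
  | .toss _ next, q => ∀ n : ℕ, (next n).QueriesAtMost q
  | .query _ _ _, 0 => False
  | .query _ _ next, q + 1 => ∀ a : Option Ω, (next a).QueriesAtMost q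

/-- What an algorithm interacts with: a condition set is answered by a random element of `Ω`, or
by the error symbol `none`. The law of the answer depends on the condition set only, and all calls
are answered independently. -/
abbrev Oracle (Ω : Type) : Type := Finset Ω → PMF (Option Ω)

/-- `O` is a conditional sampling oracle for `μ`: whenever `A` has positive probability under `μ`,
the answer to `A` is distributed like `μ` conditioned on `A`. The definition says nothing about
condition sets of probability zero, so that it covers all variants of the model (an error symbol,
a uniform element of `A`, ...). -/
def IsConditionalOracle {Ω : Type} (μ : PMF Ω) (O : Oracle Ω) : Prop :=
  ∀ (A : Finset Ω) (hA : ∃ a ∈ (A : Set Ω), a ∈ μ.support),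
    O A = (μ.filter (A : Set Ω) hA).map some

/-- The law of the output of an algorithm that is run with the oracles `O i`. -/
noncomputable def Algorithm.run {ι Ω R : Type} (O : ι → Oracle Ω) : Algorithm ι Ω R → PMF R
  | .output r => PMF.pure r
  | .toss p next => p.bind fun n => (next n).run O
  | .query i A next => (O i A).bind fun a => (next a).run O

/-- The probability that a random variable with the discrete law `p` has its value in `S`. -/
noncomputable def prob {R : Type} (p : PMF R) (S : Set R) : ENNReal := p.toOuterMeasure S

/-- The total variation distance of two distributions over a finite set. -/
noncomputable def dTV {Ω : Type} [Fintype Ω] (μ τ : PMF Ω) : ℝ :=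
  (1 / 2) * ∑ x : Ω, |(μ x).toReal - (τ x).toReal|

/-- `alg`, which has access to two conditional sampling oracles (number `0` for the first input
distribution and number `1` for the second one), estimates the total variation distance of every
two input distributions over `Ω` within an additive error of `ε`, with success probability at
least `2 / 3`, no matter how condition sets of probability zero are answered. -/
def EstimatesDTV {Ω : Type} [Fintype Ω] (ε : ℝ) (alg : Algorithm (Fin 2) Ω ℝ) : Prop :=
  ∀ (μ τ : PMF Ω) (Oμ Oτ : Oracle Ω),
    IsConditionalOracle μ Oμ → IsConditionalOracle τ Oτ →
      2 / 3 ≤ prob (alg.run ![Oμ, Oτ]) {r : ℝ | |r - dTV μ τ| ≤ ε}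

end CondSampling

/-! The distance is one minus the overlap `∑ x, min (μ x) (τ x)`, so the overlap is what has to be
estimated. With `g = overlapFun`, which is Lipschitz, takes values in [0,1] and vanishes up to 1/2,
`overlapFun_add` gives min(a,b) = a g(b/a) + b g(a/b). Hence the overlap is the mean of g(τ(x)/μ(x))
for x drawn from μ, plus the mean of g(μ(x)/τ(x)) for x drawn from τ. By Chebyshev, O(1/ε²) samples
suffice once each has bias O(ε) (`ev_distanceEstimate_ge`), so the masses are only needed with a
truncated relative error that is O(δ) in expectation, where δ is a small multiple of ε.

Let m be the mass of x and S its win rate, the chance that x is returned from the pair {x,y} for a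
random y. Elements with win rate below t have total mass at most 2t (`sum_mass_winRate_lt_le`) and
can be neglected. Otherwise S can be estimated directly, and m/S remains. For a random subset A with
inclusion probability p, the sum H of the shares of its elements concentrates around pS, because no
share exceeds m; the mass of A itself need not concentrate. If b is the mass of A together with x,
one coin shows x with probability m/b and another, which needs a second query, succeeds with
probability H/b. The unknown b cancels in the quotient, and p times the quotient is close to m/S
(`ev_ratioRound_le`).

This needs p large enough for H to concentrate, yet small enough for hits of x not to be rare. A
first p is found among O(log(N/δ)) powers of 1/2 by a noisy binary search (`ev_search_le`), which is
where log log N comes from. The resulting window of p has a width of order 1/δ, so a rough round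
precedes the fine one.

If x has a low win rate under the second distribution only, then either its mass ratio is at most
1/2, where g vanishes and an estimate 0 is harmless, or its mass under the first distribution is
charged to its mass under the second (`mass_mul_ev_overlapFun_le`). A sample costs O(log log N +
1/δ⁵) queries, which gives the theorem without any logarithmic factor in 1/ε. -/

set_option linter.unusedSectionVars false

/-! ### Decision trees with finite coin spaces, and their expectations as finite sums -/

namespace CondSampling

/-- Algorithms whose internal coins are random subsets of the domain. -/
inductive Sampler (ι Ω R : Type) : Type
  | output (r : R) : Sampler ι Ω R
  | toss (p : PMF (Finset Ω)) (next : Finset Ω → Sampler ι Ω R) : Sampler ι Ω R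
  | query (i : ι) (A : Finset Ω) (next : Option Ω → Sampler ι Ω R) : Sampler ι Ω R

namespace Sampler

variable {ι Ω R R' : Type}

/-- Sequential composition. -/
def bind : Sampler ι Ω R → (R → Sampler ι Ω R') → Sampler ι Ω R'
  | .output r, k => k r
  | .toss p next, k => .toss p fun A => (next A).bind k
  | .query i A next, k => .query i A fun a => (next a).bind k

/-- At most `q` oracle calls are made along every branch. -/
def QueriesAtMost : Sampler ι Ω R → ℕ → Prop
  | .output _, _ => True
  | .toss _ next, q => ∀ A, (next A).QueriesAtMost q
  | .query _ _ _, 0 => False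
  | .query _ _ next, q + 1 => ∀ a, (next a).QueriesAtMost q

theorem QueriesAtMost.mono {t : Sampler ι Ω R} {q q' : ℕ} (h : t.QueriesAtMost q) (hq : q ≤ q') :
    t.QueriesAtMost q' := by
  induction t generalizing q q' with
  | output r => trivial
  | toss p next ih => exact fun A => ih A (h A) hq
  | query i A next ih =>
    cases q with
    | zero => exact h.elim
    | succ q =>
      obtain ⟨q', rfl⟩ : ∃ n, q' = n + 1 := ⟨q' - 1, by omega⟩
      exact fun a => ih a (h a) (by omega)

theorem QueriesAtMost.bind {t : Sampler ι Ω R} {k : R → Sampler ι Ω R'} {q q' : ℕ}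
    (h : t.QueriesAtMost q) (hk : ∀ r, (k r).QueriesAtMost q') :
    (t.bind k).QueriesAtMost (q + q') := by
  induction t generalizing q with
  | output r => exact (hk r).mono (by omega)
  | toss p next ih => exact fun A => ih A (h A)
  | query i A next ih =>
    cases q with
    | zero => exact h.elim
    | succ q =>
      rw [Nat.add_right_comm]
      exact fun a => ih a (h a)

/-- The sum of the outputs of `n` independent runs. -/
def iterSum (t : Sampler ι Ω ℝ) : ℕ → Sampler ι Ω ℝ
  | 0 => output 0
  | n + 1 => t.bind fun a => (iterSum t n).bind fun r => output (a + r)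

theorem QueriesAtMost.iterSum {t : Sampler ι Ω ℝ} {q : ℕ} (h : t.QueriesAtMost q) (n : ℕ) :
    (t.iterSum n).QueriesAtMost (n * q) := by
  induction n with
  | zero => simp [Sampler.iterSum, QueriesAtMost]
  | succ n ih =>
    rw [Nat.succ_mul, Nat.add_comm (n * q)]
    refine h.bind fun a => ?_
    have := ih.bind (k := fun r => output (a + r)) (q' := 0) fun r => trivial
    simpa using this

/-- The corresponding algorithm, in which subsets of the domain are encoded by numbers. -/
noncomputable def toAlgorithm [Encodable Ω] : Sampler ι Ω R → Algorithm ι Ω R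
  | .output r => .output r
  -- The default `∅` below is only reached for numbers that encode no set, which have probability
  -- zero.
  | .toss p next => .toss (p.map Encodable.encode) fun n =>
      (next ((Encodable.decode n).getD ∅)).toAlgorithm
  | .query i A next => .query i A fun a => (next a).toAlgorithm

theorem QueriesAtMost.toAlgorithm [Encodable Ω] {t : Sampler ι Ω R} {q : ℕ}
    (h : t.QueriesAtMost q) : t.toAlgorithm.QueriesAtMost q := by
  induction t generalizing q with
  | output r => simp [Sampler.toAlgorithm, Algorithm.QueriesAtMost]
  | toss p next ih =>
    rw [Sampler.toAlgorithm, Algorithm.QueriesAtMost]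
    exact fun n => ih _ (h _)
  | query i A next ih =>
    cases q with
    | zero => exact h.elim
    | succ q =>
      rw [Sampler.toAlgorithm, Algorithm.QueriesAtMost]
      exact fun a => ih _ (h a)

variable [Fintype Ω]

/-- The expectation of `f` of the output when the oracles are `O`. -/
noncomputable def ev (O : ι → Oracle Ω) : Sampler ι Ω R → (R → ℝ) → ℝ
  | .output r, f => f r
  | .toss p next, f => ∑ A, (p A).toReal * (next A).ev O f
  | .query i A next, f => ∑ a, (O i A a).toReal * (next a).ev O f

variable (O : ι → Oracle Ω)

@[simp] theorem ev_output (r : R) (f : R → ℝ) : (output r : Sampler ι Ω R).ev O f = f r := rfl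

theorem ev_toss (p : PMF (Finset Ω)) (next : Finset Ω → Sampler ι Ω R) (f : R → ℝ) :
    (toss p next).ev O f = ∑ A, (p A).toReal * (next A).ev O f := rfl

theorem ev_query (i : ι) (A : Finset Ω) (next : Option Ω → Sampler ι Ω R) (f : R → ℝ) :
    (query i A next).ev O f = ∑ a, (O i A a).toReal * (next a).ev O f := rfl

@[simp] theorem ev_bind (t : Sampler ι Ω R) (k : R → Sampler ι Ω R') (f : R' → ℝ) :
    (t.bind k).ev O f = t.ev O fun r => (k r).ev O f := by
  induction t with
  | output r => rfl
  | toss p next ih => simp only [bind, ev, ih]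
  | query i A next ih => simp only [bind, ev, ih]

theorem ev_add (t : Sampler ι Ω R) (f g : R → ℝ) :
    t.ev O (fun r => f r + g r) = t.ev O f + t.ev O g := by
  induction t with
  | output r => rfl
  | toss p next ih => simp only [ev, ih, mul_add, Finset.sum_add_distrib]
  | query i A next ih => simp only [ev, ih, mul_add, Finset.sum_add_distrib]

theorem ev_const_mul (t : Sampler ι Ω R) (c : ℝ) (f : R → ℝ) :
    t.ev O (fun r => c * f r) = c * t.ev O f := by
  induction t with
  | output r => rfl
  | toss p next ih => simp only [ev, ih, Finset.mul_sum, mul_left_comm]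
  | query i A next ih => simp only [ev, ih, Finset.mul_sum, mul_left_comm]

theorem ev_mono (t : Sampler ι Ω R) {f g : R → ℝ} (h : ∀ r, f r ≤ g r) : t.ev O f ≤ t.ev O g := by
  induction t with
  | output r => exact h r
  | toss p next ih =>
    exact Finset.sum_le_sum fun A _ => mul_le_mul_of_nonneg_left (ih A) ENNReal.toReal_nonneg
  | query i A next ih =>
    exact Finset.sum_le_sum fun A _ => mul_le_mul_of_nonneg_left (ih A) ENNReal.toReal_nonneg

theorem sum_toReal_pmf {α : Type} [Fintype α] (p : PMF α) : ∑ a, (p a).toReal = 1 := by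
  rw [← ENNReal.toReal_sum fun a _ => p.apply_ne_top a]
  have := p.tsum_coe
  rw [tsum_fintype] at this
  simp [this]

@[simp] theorem ev_const (t : Sampler ι Ω R) (c : ℝ) : t.ev O (fun _ => c) = c := by
  induction t with
  | output r => rfl
  | toss p next ih => simp only [ev, ih, ← Finset.sum_mul, sum_toReal_pmf, one_mul]
  | query i A next ih => simp only [ev, ih, ← Finset.sum_mul, sum_toReal_pmf, one_mul]

theorem ev_le_of_le (t : Sampler ι Ω R) {f : R → ℝ} {c : ℝ} (h : ∀ r, f r ≤ c) : t.ev O f ≤ c :=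
  (ev_mono O t h).trans_eq (ev_const O t c)

theorem le_ev_of_le (t : Sampler ι Ω R) {f : R → ℝ} {c : ℝ} (h : ∀ r, c ≤ f r) : c ≤ t.ev O f :=
  (ev_const O t c).symm.trans_le (ev_mono O t h)

theorem ev_sub_const (t : Sampler ι Ω R) (f : R → ℝ) (c : ℝ) :
    t.ev O (fun r => f r - c) = t.ev O f - c := by
  simpa [sub_eq_add_neg] using ev_add O t f fun _ => -c

theorem abs_ev_le (t : Sampler ι Ω R) (f : R → ℝ) : |t.ev O f| ≤ t.ev O fun r => |f r| := by
  rw [abs_le]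
  refine ⟨?_, ev_mono O t fun r => le_abs_self _⟩
  have h := ev_mono O t (f := fun r => -1 * |f r|) (g := f) fun r => by
    linarith [neg_abs_le (f r)]
  rw [ev_const_mul] at h
  linarith

theorem abs_ev_sub_le (t : Sampler ι Ω R) (f : R → ℝ) (c : ℝ) :
    |t.ev O f - c| ≤ t.ev O fun r => |f r - c| := by
  rw [← ev_sub_const]
  exact abs_ev_le O t _

/-- Composition after a first stage that succeeds with probability at least `1 - δ`. -/
theorem ev_le_of_good (t : Sampler ι Ω R) (good : R → Prop) [DecidablePred good] {f : R → ℝ} {δ η : ℝ} (hη : 0 ≤ η)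
    (hgood : t.ev O (fun r => if good r then 0 else 1) ≤ δ) (h1 : ∀ r, f r ≤ 1)
    (hf : ∀ r, good r → f r ≤ η) : t.ev O f ≤ δ + η := by
  have h : t.ev O f ≤ t.ev O fun r => (if good r then 0 else 1) + η := by
    refine ev_mono O t fun r => ?_
    by_cases hr : good r
    · simpa [hr] using hf r hr
    · simpa [hr] using (h1 r).trans (by linarith)
  rw [ev_add, ev_const] at h
  linarith

open scoped Classical in
theorem prob_run_toAlgorithm [Encodable Ω] (t : Sampler ι Ω R) (s : Set R) :
    prob (t.toAlgorithm.run O) s = ENNReal.ofReal (t.ev O fun r => if r ∈ s then 1 else 0) := by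
  unfold prob
  have key : ∀ {α : Type} [Fintype α] (p : PMF α) (g : α → ℝ), (∀ a, 0 ≤ g a) →
      ∑' a, p a * ENNReal.ofReal (g a) = ENNReal.ofReal (∑ a, (p a).toReal * g a) := by
    intro α _ p g hg
    rw [tsum_fintype, ENNReal.ofReal_sum_of_nonneg
      fun a _ => mul_nonneg ENNReal.toReal_nonneg (hg a)]
    refine Finset.sum_congr rfl fun a _ => ?_
    rw [ENNReal.ofReal_mul ENNReal.toReal_nonneg, ENNReal.ofReal_toReal (p.apply_ne_top a)]
  have hnn : ∀ t : Sampler ι Ω R, 0 ≤ t.ev O fun r => if r ∈ s then (1 : ℝ) else 0 :=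
    fun t => le_ev_of_le O t fun r => by split_ifs <;> norm_num
  induction t with
  | output r =>
    rw [toAlgorithm, Algorithm.run, PMF.toOuterMeasure_pure_apply, ev_output]
    split_ifs <;> simp
  | toss p next ih =>
    rw [toAlgorithm, Algorithm.run, PMF.bind_map, PMF.toOuterMeasure_bind_apply, ev_toss,
      ← key p _ fun A => hnn (next A)]
    refine tsum_congr fun A => ?_
    simp [ih]
  | query i A next ih =>
    rw [toAlgorithm, Algorithm.run, PMF.toOuterMeasure_bind_apply, ev_query,
      ← key _ _ fun a => hnn (next a)]
    exact tsum_congr fun a => by rw [ih]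

/-- Variance plus squared bias. The centre `d` is arbitrary so that the induction can move the first
output into it. -/
theorem ev_iterSum_sq (t : Sampler ι Ω ℝ) {m s : ℝ} (h1 : t.ev O (fun r => r) = m)
    (h2 : t.ev O (fun r => r ^ 2) = s) (n : ℕ) (d : ℝ) :
    (t.iterSum n).ev O (fun r => (r - d) ^ 2) = n * (s - m ^ 2) + (n * m - d) ^ 2 := by
  induction n generalizing d with
  | zero => simp [iterSum]
  | succ n ih =>
    have h : ∀ a : ℝ, (t.iterSum n).ev O (fun r => (a + r - d) ^ 2)
        = (1 * a ^ 2 + 2 * (n * m - d) * a) + (n * (s - m ^ 2) + (n * m - d) ^ 2) := by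
      intro a
      have := ih (d - a)
      rw [show (fun r : ℝ => (a + r - d) ^ 2) = fun r => (r - (d - a)) ^ 2 by
        funext r; ring, this]
      ring
    simp only [iterSum, ev_bind, ev_output, h]
    rw [ev_add, ev_add, ev_const_mul, ev_const_mul, ev_const, h1, h2]
    push_cast
    ring

/-- A sampler that outputs `1` with probability `c` and `0` otherwise. -/
def IsCoin (t : Sampler ι Ω ℝ) (c : ℝ) : Prop :=
  ∀ f : ℝ → ℝ, t.ev O f = c * f 1 + (1 - c) * f 0

variable {O}

theorem IsCoin.ev_iterSum_sq_le {t : Sampler ι Ω ℝ} {c : ℝ} (h : IsCoin O t c) (n : ℕ) (d : ℝ) :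
    (t.iterSum n).ev O (fun r => (r - d) ^ 2) ≤ n * c + (n * c - d) ^ 2 := by
  rw [ev_iterSum_sq O t (m := c) (s := c) (by rw [h]; ring) (by rw [h]; ring)]
  nlinarith [mul_nonneg (Nat.cast_nonneg (α := ℝ) n) (sq_nonneg c)]

end Sampler
end CondSampling

namespace CondSampling
open Finset

/-! ### Random subsets -/

section Bernoulli

variable {Ω : Type} [Fintype Ω] [DecidableEq Ω]

/-- Expand the product over y of p + (1 - p) for y outside T and of p + 0 for y in T: the term of A
survives exactly if A contains T. All moments of the random subset come from this. -/
theorem sum_bernoulli_superset (p : ℝ) (T : Finset Ω) :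
    ∑ A : Finset Ω, (∏ y : Ω, if y ∈ A then p else 1 - p) * (if T ⊆ A then 1 else 0) = p ^ #T := by
  have h := Finset.prod_add (fun _ : Ω => p) (fun y => if y ∈ T then 0 else 1 - p) univ
  have hl : ∏ y : Ω, (p + if y ∈ T then 0 else 1 - p) = p ^ #T := by
    rw [← Finset.prod_const, ← Finset.prod_subset (Finset.subset_univ T)]
    · exact Finset.prod_congr rfl fun y hy => by simp [hy]
    · intro y _ hy
      simp [hy]
  rw [← hl, h, Finset.powerset_univ]
  refine Finset.sum_congr rfl fun A _ => ?_
  have h1 : ∏ y : Ω, (if y ∈ A then p else 1 - p) = (∏ y ∈ A, p) * ∏ y ∈ univ \ A, (1 - p) := by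
    rw [← Finset.prod_sdiff (Finset.subset_univ A), mul_comm]
    congr 1
    · exact Finset.prod_congr rfl fun y hy => by simp [hy]
    · exact Finset.prod_congr rfl fun y hy => by simp [(Finset.mem_sdiff.1 hy).2]
  rw [h1, mul_assoc]
  congr 1
  by_cases hT : T ⊆ A
  · simp only [hT, if_true, mul_one]
    refine Finset.prod_congr rfl fun y hy => ?_
    rw [if_neg fun hyT => (Finset.mem_sdiff.1 hy).2 (hT hyT)]
  · simp only [hT, if_false, mul_zero]
    obtain ⟨y, hyT, hyA⟩ := Finset.not_subset.1 hT
    exact (Finset.prod_eq_zero (i := y) (by simp [hyA]) (by simp [hyT])).symm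

/-- `p` truncated to the unit interval. -/
noncomputable def clamp (p : ℝ) : ℝ := max 0 (min 1 p)

theorem clamp_nonneg (p : ℝ) : 0 ≤ clamp p := le_max_left _ _

theorem clamp_le_one (p : ℝ) : clamp p ≤ 1 := max_le zero_le_one (min_le_left _ _)

theorem clamp_eq_min {p : ℝ} (hp : 0 ≤ p) : clamp p = min 1 p :=
  max_eq_right (le_min zero_le_one hp)

/-- The law of a random subset that contains every element independently with probability
`clamp p`. -/
noncomputable def bernoulliSubset (p : ℝ) : PMF (Finset Ω) :=
  PMF.ofFintype
    (fun A => ENNReal.ofReal (∏ y : Ω, if y ∈ A then clamp p else 1 - clamp p)) <| by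
      have h : ∀ A : Finset Ω, 0 ≤ ∏ y : Ω, if y ∈ A then clamp p else 1 - clamp p := fun A =>
        Finset.prod_nonneg fun y _ => by
          split_ifs
          · exact clamp_nonneg p
          · linarith [clamp_le_one p]
      rw [← ENNReal.ofReal_sum_of_nonneg fun A _ => h A]
      have := sum_bernoulli_superset (clamp p) (∅ : Finset Ω)
      simp only [Finset.empty_subset, if_true, mul_one, Finset.card_empty, pow_zero] at this
      simp [this]

theorem bernoulliSubset_apply_toReal (p : ℝ) (A : Finset Ω) :
    (bernoulliSubset p A).toReal = ∏ y : Ω, if y ∈ A then clamp p else 1 - clamp p := by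
  rw [bernoulliSubset, PMF.ofFintype_apply, ENNReal.toReal_ofReal]
  exact Finset.prod_nonneg fun y _ => by
    split_ifs
    · exact clamp_nonneg p
    · linarith [clamp_le_one p]

theorem bernoulliSubset_mean (p : ℝ) (f : Ω → ℝ) :
    ∑ A : Finset Ω, (bernoulliSubset p A).toReal * ∑ y ∈ A, f y = clamp p * ∑ y, f y := by
  have h : ∀ A : Finset Ω, (bernoulliSubset p A).toReal * ∑ y ∈ A, f y
      = ∑ y, f y * ((bernoulliSubset p A).toReal * if ({y} : Finset Ω) ⊆ A then 1 else 0) := by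
    intro A
    rw [Finset.mul_sum, ← Finset.sum_subset (Finset.subset_univ A)]
    · exact Finset.sum_congr rfl fun y hy => by simp [hy, mul_comm]
    · intro y _ hy
      simp [hy]
  simp_rw [h]
  rw [Finset.sum_comm, Finset.mul_sum]
  refine Finset.sum_congr rfl fun y _ => ?_
  rw [← Finset.mul_sum]
  simp_rw [bernoulliSubset_apply_toReal]
  rw [sum_bernoulli_superset]
  simp [mul_comm]

/-- A pair y, z lies in A with probability p² off the diagonal and p on it; the second term is this
correction. -/
theorem bernoulliSubset_mean_mul (p : ℝ) (f g : Ω → ℝ) :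
    ∑ A : Finset Ω, (bernoulliSubset p A).toReal * ((∑ y ∈ A, f y) * ∑ y ∈ A, g y)
      = clamp p ^ 2 * ((∑ y, f y) * ∑ y, g y) + (clamp p - clamp p ^ 2) * ∑ y, f y * g y := by
  have h : ∀ A : Finset Ω, (bernoulliSubset p A).toReal * ((∑ y ∈ A, f y) * ∑ y ∈ A, g y)
      = ∑ y, ∑ z, f y * g z *
        ((bernoulliSubset p A).toReal * if ({y, z} : Finset Ω) ⊆ A then 1 else 0) := by
    intro A
    rw [Finset.sum_mul_sum, Finset.mul_sum, ← Finset.sum_subset (Finset.subset_univ A)]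
    · refine Finset.sum_congr rfl fun y hy => ?_
      rw [Finset.mul_sum, ← Finset.sum_subset (Finset.subset_univ A)]
      · refine Finset.sum_congr rfl fun z hz => ?_
        rw [if_pos (by simp [Finset.insert_subset_iff, hy, hz])]
        ring
      · intro z _ hz
        simp [Finset.insert_subset_iff, hz]
    · intro y _ hy
      simp [Finset.insert_subset_iff, hy]
  simp_rw [h]
  have hyz : ∀ y z : Ω, ∑ A : Finset Ω,
      f y * g z * ((bernoulliSubset p A).toReal * if ({y, z} : Finset Ω) ⊆ A then 1 else 0)
      = clamp p ^ 2 * (f y * g z) + if y = z then (clamp p - clamp p ^ 2) * (f y * g z) else 0 := by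
    intro y z
    rw [← Finset.mul_sum]
    simp_rw [bernoulliSubset_apply_toReal]
    rw [sum_bernoulli_superset]
    by_cases hyz : y = z
    · subst hyz
      simp
      ring
    · rw [Finset.card_pair hyz]
      simp [hyz]
      ring
  rw [Finset.sum_comm]
  have : ∀ y : Ω, ∑ A : Finset Ω, ∑ z,
      f y * g z * ((bernoulliSubset p A).toReal * if ({y, z} : Finset Ω) ⊆ A then 1 else 0)
      = clamp p ^ 2 * (f y * ∑ z, g z) + (clamp p - clamp p ^ 2) * (f y * g y) := by
    intro y
    rw [Finset.sum_comm, Finset.sum_congr rfl fun z _ => hyz y z, Finset.sum_add_distrib]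
    simp [Finset.mul_sum]
  rw [Finset.sum_congr rfl fun y _ => this y, Finset.sum_add_distrib, ← Finset.mul_sum,
    ← Finset.mul_sum, ← Finset.sum_mul]

end Bernoulli

/-! ### Noisy search -/

section Search

/-- A median of a list of numbers. -/
noncomputable def listMedian (l : List ℕ) : ℕ :=
  sInf {m | l.length ≤ 2 * l.countP (· ≤ m)}

theorem listMedian_mem (l : List ℕ) {a b : ℕ}
    (h : 2 * l.countP (fun j => j < a ∨ b < j) < l.length) :
    a ≤ listMedian l ∧ listMedian l ≤ b := by
  have hb : l.length ≤ 2 * l.countP (· ≤ b) := by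
    have h1 := l.length_eq_countP_add_countP (p := fun j => decide (j ≤ b))
    have h2 : l.countP (fun j => ¬ decide (j ≤ b) = true) ≤
        l.countP (fun j => j < a ∨ b < j) := by
      refine List.countP_mono_left fun j _ hj => ?_
      simp at hj ⊢
      omega
    omega
  have hmem := Nat.sInf_mem (s := {m | l.length ≤ 2 * l.countP (· ≤ m)}) ⟨b, hb⟩
  refine ⟨?_, Nat.sInf_le hb⟩
  by_contra hlt
  push Not at hlt
  have h2 : l.countP (fun j => decide (j ≤ listMedian l)) ≤
      l.countP (fun j => j < a ∨ b < j) := by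
    refine List.countP_mono_left fun j _ hj => ?_
    simp at hj ⊢
    omega
  have : l.length ≤ 2 * l.countP (· ≤ listMedian l) := hmem
  omega

/-- The total weight of the candidates in `s`, when `pen i` penalties were given to `i`. -/
noncomputable def weight (s : Finset ℕ) (pen : ℕ → ℕ) : ℝ := ∑ i ∈ s, (1 / 4 : ℝ) ^ pen i

/-- Take the first prefix that carries half of the weight; by minimality the suffix from its last
element also carries half. Both halves contain `j`, so either answer to a test at `j` penalizes half
of the weight. -/
theorem exists_weighted_median (M : ℕ) (pen : ℕ → ℕ) : ∃ j ≤ M,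
    weight (range (M + 1)) pen ≤ 2 * weight ((range (M + 1)).filter (· ≤ j)) pen ∧
    weight (range (M + 1)) pen ≤ 2 * weight ((range (M + 1)).filter (j ≤ ·)) pen := by
  classical
  have hnn : ∀ s, 0 ≤ weight s pen := fun s => Finset.sum_nonneg fun i _ => by positivity
  have hM : weight (range (M + 1)) pen ≤ 2 * weight ((range (M + 1)).filter (· ≤ M)) pen := by
    rw [Finset.filter_true_of_mem fun i hi => by simp at hi; omega]
    linarith [hnn (range (M + 1))]
  let P : ℕ → Prop := fun j =>
    weight (range (M + 1)) pen ≤ 2 * weight ((range (M + 1)).filter (· ≤ j)) pen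
  have hP : ∃ j, P j := ⟨M, hM⟩
  obtain ⟨k, hk, hmin⟩ : ∃ k, P k ∧ ∀ m < k, ¬ P m :=
    ⟨Nat.find hP, Nat.find_spec hP, fun m => Nat.find_min hP⟩
  refine ⟨k, not_lt.1 fun h => hmin M h hM, hk, ?_⟩
  have hsplit : weight ((range (M + 1)).filter (k ≤ ·)) pen
      + weight ((range (M + 1)).filter (fun i => ¬ k ≤ i)) pen = weight (range (M + 1)) pen :=
    Finset.sum_filter_add_sum_filter_not _ _ _
  rcases Nat.eq_zero_or_pos k with h0 | h0
  · rw [h0, Finset.filter_true_of_mem fun i hi => by omega]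
    linarith [hnn (range (M + 1))]
  · have hlt := hmin (k - 1) (by omega)
    have heq : (range (M + 1)).filter (fun i => ¬ k ≤ i) = (range (M + 1)).filter (· ≤ k - 1) := by
      ext i
      simp only [mem_filter]
      constructor <;> rintro ⟨h1, h2⟩ <;> exact ⟨h1, by omega⟩
    rw [heq] at hsplit
    simp only [P, not_le] at hlt
    linarith

/-- A weighted median of the candidates `0, …, M`. -/
noncomputable def weightedMedian (M : ℕ) (pen : ℕ → ℕ) : ℕ := (exists_weighted_median M pen).choose

variable {ι Ω : Type}

/-- One more penalty for the candidates on the wrong side of `j`, if the answer to the question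
whether the target is at most `j` is `ans`. -/
def penalize (pen : ℕ → ℕ) (j : ℕ) (ans : Bool) (i : ℕ) : ℕ :=
  if (if ans then j ≤ i else i ≤ j) then pen i + 1 else pen i

/-- Noisy search among `0, …, M` with multiplicative weights: `T` further tests are made, and the
output is a median of all tested candidates. -/
noncomputable def search (M : ℕ) (test : ℕ → Sampler ι Ω Bool) :
    ℕ → (ℕ → ℕ) → List ℕ → Sampler ι Ω ℕ
  | 0, _, hist => .output (listMedian hist)
  | T + 1, pen, hist => (test (weightedMedian M pen)).bind fun ans =>
      search M test T (penalize pen (weightedMedian M pen) ans) (weightedMedian M pen :: hist)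

theorem search_queriesAtMost (M : ℕ) {test : ℕ → Sampler ι Ω Bool} {q : ℕ}
    (h : ∀ j, (test j).QueriesAtMost q) (T : ℕ) (pen : ℕ → ℕ) (hist : List ℕ) :
    (search M test T pen hist).QueriesAtMost (T * q) := by
  induction T generalizing pen hist with
  | zero => simp [search, Sampler.QueriesAtMost]
  | succ T ih =>
    rw [Nat.succ_mul, Nat.add_comm (T * q)]
    exact (h _).bind fun _ => ih _ _

/-- At least half of the weight loses three quarters of its value, and 1 - 3/8 = 5/8. -/
theorem weight_penalize_le (M : ℕ) (pen : ℕ → ℕ) (ans : Bool) :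
    weight (range (M + 1)) (penalize pen (weightedMedian M pen) ans)
      ≤ 5 / 8 * weight (range (M + 1)) pen := by
  set j := weightedMedian M pen with hj
  obtain ⟨-, h1, h2⟩ := (exists_weighted_median M pen).choose_spec
  change weight _ pen ≤ 2 * weight ((range (M + 1)).filter (· ≤ j)) pen at h1
  change weight _ pen ≤ 2 * weight ((range (M + 1)).filter (j ≤ ·)) pen at h2
  have key : ∀ Q : ℕ → Prop, ∀ [DecidablePred Q],
      weight (range (M + 1)) pen ≤ 2 * weight ((range (M + 1)).filter Q) pen →
      ∑ i ∈ range (M + 1), (1 / 4 : ℝ) ^ (if Q i then pen i + 1 else pen i)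
        ≤ 5 / 8 * weight (range (M + 1)) pen := by
    intro Q _ hQ
    have : ∑ i ∈ range (M + 1), (1 / 4 : ℝ) ^ (if Q i then pen i + 1 else pen i)
        = weight (range (M + 1)) pen - 3 / 4 * weight ((range (M + 1)).filter Q) pen := by
      unfold weight
      rw [Finset.sum_filter, Finset.mul_sum, ← Finset.sum_sub_distrib]
      refine Finset.sum_congr rfl fun i _ => ?_
      split_ifs
      · rw [pow_succ]; ring
      · ring
    rw [this]
    linarith
  cases ans
  · simpa [weight, penalize] using key (· ≤ j) h1
  · simpa [weight, penalize] using key (j ≤ ·) h2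

open scoped Classical in
-- The right-hand side is a potential that does not increase in expectation. A test outside [a,b]
-- multiplies weight times `2 ^ (pen a + pen b)` by at most 7/10 on average, and a test inside by at
-- most 13/10, whatever the reliability strictly between `a` and `b`; the factors 10/7 and 10/13
-- compensate for this. An output outside [a,b] forces at least `R` of the `2 * R` tests to lie
-- outside, and then the potential is at least 1.
theorem ev_search_le [Fintype Ω] (O : ι → Oracle Ω) (M : ℕ) (test : ℕ → Sampler ι Ω Bool)
    {a b : ℕ} (hab : a < b) (hb : b ≤ M)
    (hno : ∀ j ≤ a, (test j).ev O (fun r => if r then 1 else 0) ≤ 1 / 50)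
    (hyes : ∀ j, b ≤ j → j ≤ M → (test j).ev O (fun r => if r then 0 else 1) ≤ 1 / 50)
    (R T : ℕ) (pen : ℕ → ℕ) (hist : List ℕ) (hT : T + hist.length = 2 * R) :
    (search M test T pen hist).ev O (fun m => if a ≤ m ∧ m ≤ b then 0 else 1)
      ≤ weight (range (M + 1)) pen * 2 ^ (pen a + pen b) *
        ((10 / 7) ^ hist.countP (fun j => j < a ∨ b < j) *
          (10 / 13) ^ hist.countP (fun j => ¬ (j < a ∨ b < j)) * (91 / 100) ^ R) := by
  induction T generalizing pen hist with
  | zero =>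
    simp only [search, Sampler.ev_output]
    have hpos : 0 ≤ weight (range (M + 1)) pen := Finset.sum_nonneg fun i _ => by positivity
    split_ifs with hm
    · positivity
    have hD : R ≤ hist.countP (fun j => j < a ∨ b < j) := by
      by_contra hlt
      exact hm (listMedian_mem hist (by omega))
    have hI : hist.countP (fun j => ¬ (j < a ∨ b < j)) ≤ R := by
      have := hist.length_eq_countP_add_countP (p := fun j => decide (j < a ∨ b < j))
      simp only [decide_eq_true_eq] at this
      omega
    have h1 : (1 : ℝ) ≤ (10 / 7) ^ hist.countP (fun j => j < a ∨ b < j) *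
          (10 / 13) ^ hist.countP (fun j => ¬ (j < a ∨ b < j)) * (91 / 100) ^ R := by
      -- The base 91/100 is the product of 7/10 and 13/10, so the three factors balance for equally
      -- many tests inside and outside.
      calc (1 : ℝ) = (10 / 7) ^ R * (10 / 13) ^ R * (91 / 100) ^ R := by
            rw [← mul_pow, ← mul_pow]; norm_num
        _ ≤ _ := by
            gcongr ?_ * ?_ * _
            · exact pow_le_pow_right₀ (by norm_num) hD
            · exact pow_le_pow_of_le_one (by norm_num) (by norm_num) hI
    have h2 : (1 : ℝ) ≤ weight (range (M + 1)) pen * 2 ^ (pen a + pen b) := by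
      -- The less penalized of `a` and `b` alone has enough weight, as 4 to its penalties is at most
      -- `2 ^ (pen a + pen b)`.
      have hmin : (1 / 4 : ℝ) ^ min (pen a) (pen b) ≤ weight (range (M + 1)) pen := by
        rcases min_choice (pen a) (pen b) with h | h <;> rw [h]
        · exact Finset.single_le_sum (f := fun i => (1 / 4 : ℝ) ^ pen i)
            (fun i _ => by positivity) (by simp; omega)
        · exact Finset.single_le_sum (f := fun i => (1 / 4 : ℝ) ^ pen i)
            (fun i _ => by positivity) (by simp; omega)
      calc (1 : ℝ) = (1 / 4 : ℝ) ^ min (pen a) (pen b) * 2 ^ (2 * min (pen a) (pen b)) := by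
            rw [pow_mul, ← mul_pow]; norm_num
        _ ≤ _ := by
            gcongr
            · norm_num
            · omega
    nlinarith
  | succ T ih =>
    simp only [search, Sampler.ev_bind]
    set j := weightedMedian M pen with hj
    have hjM : j ≤ M := (exists_weighted_median M pen).choose_spec.1
    set W := weight (range (M + 1)) pen with hW
    have hWpos : 0 ≤ W := Finset.sum_nonneg fun i _ => by positivity
    set D := hist.countP (fun j => j < a ∨ b < j) with hD
    set I := hist.countP (fun j => ¬ (j < a ∨ b < j)) with hI
    set D' := (j :: hist).countP (fun j => j < a ∨ b < j) with hD'
    set I' := (j :: hist).countP (fun j => ¬ (j < a ∨ b < j)) with hI'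
    set G : ℝ := (10 / 7) ^ D' * (10 / 13) ^ I' * (91 / 100) ^ R with hG
    have hGpos : 0 ≤ G := by positivity
    set e : Bool → ℕ := fun ans =>
      penalize pen j ans a + penalize pen j ans b with he
    have hstep : ∀ ans, (search M test T (penalize pen j ans) (j :: hist)).ev O
        (fun m => if a ≤ m ∧ m ≤ b then 0 else 1) ≤ 5 / 8 * W * 2 ^ e ans * G := by
      intro ans
      refine (ih (penalize pen j ans) (j :: hist) (by simp; omega)).trans ?_
      gcongr
      exact weight_penalize_le M pen ans
    have hyesno : (test j).ev O (fun r => if r then (1 : ℝ) else 0)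
        + (test j).ev O (fun r => if r then 0 else 1) = 1 := by
      rw [← Sampler.ev_add]
      convert Sampler.ev_const O (test j) 1 using 2
      funext r
      cases r <;> simp
    have hy0 : 0 ≤ (test j).ev O (fun r => if r then (1 : ℝ) else 0) :=
      Sampler.le_ev_of_le O _ fun r => by split_ifs <;> norm_num
    have hn0 : 0 ≤ (test j).ev O (fun r => if r then (0 : ℝ) else 1) :=
      Sampler.le_ev_of_le O _ fun r => by split_ifs <;> norm_num
    have hsum : (test j).ev O (fun ans => (search M test T (penalize pen j ans) (j :: hist)).ev O
        (fun m => if a ≤ m ∧ m ≤ b then 0 else 1))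
        ≤ 5 / 8 * W * 2 ^ e true * G * (test j).ev O (fun r => if r then (1 : ℝ) else 0)
          + 5 / 8 * W * 2 ^ e false * G * (test j).ev O (fun r => if r then 0 else 1) := by
      rw [← Sampler.ev_const_mul, ← Sampler.ev_const_mul, ← Sampler.ev_add]
      refine Sampler.ev_mono O _ fun r => ?_
      cases r <;> simpa using hstep _
    refine hsum.trans ?_
    set y := (test j).ev O (fun r => if r then (1 : ℝ) else 0) with hy
    set n := (test j).ev O (fun r => if r then (0 : ℝ) else 1) with hn
    have hn1 : n = 1 - y := by linarith
    have hpow1 : (2 : ℝ) ^ (pen a + pen b + 1) = 2 * 2 ^ (pen a + pen b) := by ring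
    have hpow2 : (2 : ℝ) ^ (pen a + pen b + 2) = 4 * 2 ^ (pen a + pen b) := by ring
    by_cases hout : j < a ∨ b < j
    · have hD1 : D' = D + 1 := by simp [hD', hD, hout]
      have hI1 : I' = I := by simp [hI', hI, List.countP_cons]; omega
      -- Outside, a correct answer penalizes neither `a` nor `b` and a wrong one penalizes both: 5/8
      -- · (49/50 + 4/50) < 7/10.
      have hfac : 5 / 8 * 2 ^ e true * y + 5 / 8 * 2 ^ e false * n
          ≤ 7 / 10 * (2 : ℝ) ^ (pen a + pen b) := by
        have hp : (0 : ℝ) < 2 ^ (pen a + pen b) := by positivity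
        rcases hout with hlt | hlt
        · have : y ≤ 1 / 50 := hno j hlt.le
          have e1 : e true = pen a + pen b + 2 := by
            simp only [he, penalize, if_true]; split_ifs <;> omega
          have e2 : e false = pen a + pen b := by
            simp only [he, penalize, Bool.false_eq_true, if_false]; split_ifs <;> omega
          rw [e1, e2, hpow2, hn1]
          nlinarith
        · have : n ≤ 1 / 50 := hyes j hlt.le hjM
          have e1 : e true = pen a + pen b := by
            simp only [he, penalize, if_true]; split_ifs <;> omega
          have e2 : e false = pen a + pen b + 2 := by
            simp only [he, penalize, Bool.false_eq_true, if_false]; split_ifs <;> omega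
          rw [e1, e2, hpow2]
          nlinarith
      have hGe : G = 10 / 7 * ((10 / 7) ^ D * (10 / 13) ^ I * (91 / 100) ^ R) := by
        rw [hG, hD1, hI1, pow_succ]; ring
      have := mul_le_mul_of_nonneg_left hfac (mul_nonneg hWpos hGpos)
      rw [hGe] at this ⊢
      linarith
    · have hD1 : D' = D := by simp [hD', hD, List.countP_cons]; omega
      have hI1 : I' = I + 1 := by simp [hI', hI, List.countP_cons]; omega
      -- Strictly inside, each answer penalizes exactly one of `a`, `b`, which gives 5/8 · 2. At an
      -- endpoint an unlikely wrong answer penalizes both, which gives at most 5/8 · (2 + 2/50).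
      have hfac : 5 / 8 * 2 ^ e true * y + 5 / 8 * 2 ^ e false * n
          ≤ 13 / 10 * (2 : ℝ) ^ (pen a + pen b) := by
        have hp : (0 : ℝ) < 2 ^ (pen a + pen b) := by positivity
        push Not at hout
        rcases hout.1.eq_or_lt with hja | hja
        · have : y ≤ 1 / 50 := hno j hja.ge
          have e1 : e true = pen a + pen b + 2 := by
            simp only [he, penalize, if_true]; split_ifs <;> omega
          have e2 : e false = pen a + pen b + 1 := by
            simp only [he, penalize, Bool.false_eq_true, if_false]; split_ifs <;> omega
          rw [e1, e2, hpow2, hpow1, hn1]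
          nlinarith
        rcases hout.2.eq_or_lt with hjb | hjb
        · have : n ≤ 1 / 50 := hyes j hjb.ge hjM
          have e1 : e true = pen a + pen b + 1 := by
            simp only [he, penalize, if_true]; split_ifs <;> omega
          have e2 : e false = pen a + pen b + 2 := by
            simp only [he, penalize, Bool.false_eq_true, if_false]; split_ifs <;> omega
          rw [e1, e2, hpow2, hpow1]
          nlinarith
        · have e1 : e true = pen a + pen b + 1 := by
            simp only [he, penalize, if_true]; split_ifs <;> omega
          have e2 : e false = pen a + pen b + 1 := by
            simp only [he, penalize, Bool.false_eq_true, if_false]; split_ifs <;> omega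
          rw [e1, e2, hpow1, hn1]
          nlinarith
      have hGe : G = 10 / 13 * ((10 / 7) ^ D * (10 / 13) ^ I * (91 / 100) ^ R) := by
        rw [hG, hD1, hI1, pow_succ]; ring
      have := mul_le_mul_of_nonneg_left hfac (mul_nonneg hWpos hGpos)
      rw [hGe] at this ⊢
      linarith

end Search
end CondSampling

namespace CondSampling
open Finset

/-! ### Point masses and conditional queries -/

section Mass

variable {Ω : Type} [Fintype Ω] [DecidableEq Ω] (μ : PMF Ω)

/-- The probability of `x` as a real number. -/
noncomputable def mass (x : Ω) : ℝ := (μ x).toReal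

/-- The probability of the set `A` as a real number. -/
noncomputable def massOn (A : Finset Ω) : ℝ := ∑ y ∈ A, mass μ y

theorem mass_nonneg (x : Ω) : 0 ≤ mass μ x := ENNReal.toReal_nonneg

theorem massOn_nonneg (A : Finset Ω) : 0 ≤ massOn μ A := Finset.sum_nonneg fun y _ => mass_nonneg μ y

theorem sum_mass : ∑ y, mass μ y = 1 := Sampler.sum_toReal_pmf μ

theorem mass_le_massOn {x : Ω} {A : Finset Ω} (hx : x ∈ A) : mass μ x ≤ massOn μ A :=
  Finset.single_le_sum (f := mass μ) (fun y _ => mass_nonneg μ y) hx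

theorem massOn_insert_le (x : Ω) (A : Finset Ω) :
    massOn μ (insert x A) ≤ massOn μ A + mass μ x := by
  by_cases hx : x ∈ A
  · rw [Finset.insert_eq_of_mem hx]
    linarith [mass_nonneg μ x]
  · rw [massOn, Finset.sum_insert hx, massOn, add_comm]

theorem massOn_le_massOn_insert (x : Ω) (A : Finset Ω) : massOn μ A ≤ massOn μ (insert x A) :=
  Finset.sum_le_sum_of_subset_of_nonneg (Finset.subset_insert x A) fun y _ _ => mass_nonneg μ y

theorem mass_le_massOn_insert (x : Ω) (A : Finset Ω) : mass μ x ≤ massOn μ (insert x A) :=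
  mass_le_massOn μ (Finset.mem_insert_self x A)

/-- The part of the mass of `y` that remains when `y` is kept with the probability of `x` in
the pair `x, y`. -/
noncomputable def share (x y : Ω) : ℝ := mass μ y * mass μ x / massOn μ {x, y}

theorem share_nonneg (x y : Ω) : 0 ≤ share μ x y :=
  div_nonneg (mul_nonneg (mass_nonneg μ y) (mass_nonneg μ x)) (massOn_nonneg μ _)

theorem share_le_left (x y : Ω) : share μ x y ≤ mass μ x := by
  rw [share, mul_div_right_comm]
  refine mul_le_of_le_one_left (mass_nonneg μ x) (div_le_one_of_le₀ ?_ (massOn_nonneg μ _))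
  exact mass_le_massOn μ (by simp)

theorem share_le_right (x y : Ω) : share μ x y ≤ mass μ y := by
  rw [share, mul_div_assoc]
  refine mul_le_of_le_one_right (mass_nonneg μ y) (div_le_one_of_le₀ ?_ (massOn_nonneg μ _))
  exact mass_le_massOn μ (by simp)

theorem share_self (x : Ω) : share μ x x = mass μ x := by
  simp [share, massOn]

/-- The probability that `x` wins against an independent random element. -/
noncomputable def winRate (x : Ω) : ℝ := ∑ y, share μ x y

theorem mass_le_winRate (x : Ω) : mass μ x ≤ winRate μ x := by
  rw [← share_self]
  exact Finset.single_le_sum (f := share μ x) (fun y _ => share_nonneg μ x y) (Finset.mem_univ x)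

theorem winRate_nonneg (x : Ω) : 0 ≤ winRate μ x := (mass_nonneg μ x).trans (mass_le_winRate μ x)

theorem winRate_le_one (x : Ω) : winRate μ x ≤ 1 :=
  (Finset.sum_le_sum fun y _ => share_le_right μ x y).trans_eq (sum_mass μ)

theorem winRate_le_card_mul (x : Ω) : winRate μ x ≤ Fintype.card Ω * mass μ x := by
  refine (Finset.sum_le_sum fun y _ => share_le_left μ x y).trans_eq ?_
  simp [Finset.card_univ]

theorem mass_pos_of_winRate_pos {x : Ω} (h : 0 < winRate μ x) : 0 < mass μ x := by
  rcases (mass_nonneg μ x).eq_or_lt with h0 | h0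
  · have := winRate_le_card_mul μ x
    rw [← h0, mul_zero] at this
    linarith
  · exact h0

/-- In the pair of two distinct elements one of them wins, so their winning chances add up to 1. On
the diagonal the right-hand side is twice the left. -/
theorem mass_mul_mass_le (x y : Ω) :
    mass μ x * mass μ y ≤ mass μ x * share μ x y + mass μ y * share μ y x := by
  by_cases hxy : x = y
  · subst hxy
    rw [share_self]
    nlinarith [mul_nonneg (mass_nonneg μ x) (mass_nonneg μ x)]
  · rw [share, share, Finset.pair_comm y x, massOn, Finset.sum_pair hxy]
    rcases (add_nonneg (mass_nonneg μ x) (mass_nonneg μ y)).eq_or_lt with h | h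
    · have h1 : mass μ x = 0 := by linarith [mass_nonneg μ x, mass_nonneg μ y]
      simp [h1]
    · refine le_of_eq ?_
      field_simp

open scoped Classical in
-- Let L be the mass of the elements with win rate below t. Two independent samples both have low
-- win rate with probability L², and one of them wins their comparison. By symmetry this costs at
-- most twice the chance that the first is such an element and wins, hence L² ≤ 2tL.
theorem sum_mass_winRate_lt_le (t : ℝ) (ht : 0 ≤ t) :
    ∑ x, (if winRate μ x < t then mass μ x else 0) ≤ 2 * t := by
  set b : Ω → ℝ := fun x => if winRate μ x < t then 1 else 0 with hb
  have hb0 : ∀ x, 0 ≤ b x := fun x => by simp only [hb]; split_ifs <;> norm_num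
  have hb1 : ∀ x, b x ≤ 1 := fun x => by simp only [hb]; split_ifs <;> norm_num
  have hL : ∑ x, (if winRate μ x < t then mass μ x else 0) = ∑ x, b x * mass μ x :=
    Finset.sum_congr rfl fun x _ => by simp only [hb]; split_ifs <;> simp
  rw [hL]
  set L := ∑ x, b x * mass μ x with hLdef
  have h1 : L * L ≤ ∑ x, ∑ y, b x * b y * (mass μ x * share μ x y + mass μ y * share μ y x) := by
    rw [hLdef, Finset.sum_mul_sum]
    refine Finset.sum_le_sum fun x _ => Finset.sum_le_sum fun y _ => ?_
    rw [mul_mul_mul_comm]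
    exact mul_le_mul_of_nonneg_left (mass_mul_mass_le μ x y) (mul_nonneg (hb0 x) (hb0 y))
  have h2 : ∑ x, ∑ y, b x * b y * (mass μ x * share μ x y + mass μ y * share μ y x)
      = 2 * ∑ x, ∑ y, b x * b y * (mass μ x * share μ x y) := by
    simp_rw [mul_add, Finset.sum_add_distrib]
    rw [two_mul]
    congr 1
    rw [Finset.sum_comm]
    exact Finset.sum_congr rfl fun x _ => Finset.sum_congr rfl fun y _ => by ring
  have h3 : ∑ x, ∑ y, b x * b y * (mass μ x * share μ x y) ≤ ∑ x, b x * mass μ x * t := by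
    refine Finset.sum_le_sum fun x _ => ?_
    have h4 : ∑ y, b x * b y * (mass μ x * share μ x y) ≤ b x * mass μ x * winRate μ x := by
      rw [winRate, Finset.mul_sum]
      refine Finset.sum_le_sum fun y _ => ?_
      have := mul_nonneg (mul_nonneg (hb0 x) (mass_nonneg μ x)) (share_nonneg μ x y)
      nlinarith [hb1 y]
    refine h4.trans ?_
    by_cases hx : winRate μ x < t
    · exact mul_le_mul_of_nonneg_left hx.le (mul_nonneg (hb0 x) (mass_nonneg μ x))
    · simp [hb, hx]
  rw [← Finset.sum_mul] at h3
  have hL0 : 0 ≤ L := Finset.sum_nonneg fun x _ => mul_nonneg (hb0 x) (mass_nonneg μ x)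
  by_contra hlt
  push Not at hlt
  nlinarith

variable {ι R : Type} {O : ι → Oracle Ω} {i : ι} {μ}

theorem ev_query_eq (hO : IsConditionalOracle μ (O i)) {A : Finset Ω} (hA : 0 < massOn μ A)
    (next : Option Ω → Sampler ι Ω R) (f : R → ℝ) :
    (Sampler.query i A next).ev O f
      = ∑ y ∈ A, mass μ y / massOn μ A * (next (some y)).ev O f := by
  have hex : ∃ a ∈ (A : Set Ω), a ∈ μ.support := by
    obtain ⟨a, ha, h⟩ := Finset.exists_ne_zero_of_sum_ne_zero hA.ne'
    refine ⟨a, ha, ?_⟩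
    rw [PMF.mem_support_iff]
    intro h0
    exact h (by simp [mass, h0])
  rw [Sampler.ev_query, hO A hex, Fintype.sum_option]
  have hnone : ((μ.filter (A : Set Ω) hex).map some) none = 0 := by
    rw [PMF.map_apply]
    simp
  have hsome : ∀ y, (((μ.filter (A : Set Ω) hex).map some) (some y)).toReal
      = if y ∈ A then mass μ y / massOn μ A else 0 := by
    intro y
    have : ((μ.filter (A : Set Ω) hex).map some) (some y) = μ.filter (A : Set Ω) hex y := by
      rw [PMF.map_apply, tsum_eq_single y]
      · simp
      · intro z hz
        rw [if_neg]
        simpa using hz.symm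
    rw [this, PMF.filter_apply, tsum_fintype]
    by_cases hy : y ∈ A
    · rw [if_pos hy, Set.indicator_of_mem (by exact_mod_cast hy), ENNReal.toReal_mul,
        ENNReal.toReal_inv, div_eq_mul_inv]
      congr 2
      rw [ENNReal.toReal_sum]
      · rw [massOn, ← Finset.sum_subset (Finset.subset_univ A)]
        · exact Finset.sum_congr rfl fun z hz => by
            rw [Set.indicator_of_mem (by exact_mod_cast hz)]; rfl
        · intro z _ hz
          rw [Set.indicator_of_notMem (by exact_mod_cast hz)]
          rfl
      · intro z _
        by_cases hz : z ∈ (A : Set Ω)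
        · rw [Set.indicator_of_mem hz]; exact μ.apply_ne_top z
        · rw [Set.indicator_of_notMem hz]; exact ENNReal.zero_ne_top
    · rw [if_neg hy, Set.indicator_of_notMem (by exact_mod_cast hy)]
      simp
  rw [hnone]
  simp_rw [hsome]
  simp [ite_mul, Finset.sum_ite_mem]

/-- Ask for a sample from `A` together with `x`, and output whether it is `x`. -/
noncomputable def hitTest (i : ι) (x : Ω) (A : Finset Ω) (u v : R) : Sampler ι Ω R :=
  .query i (insert x A) fun a => .output (if a = some x then u else v)

theorem ev_hitTest (hO : IsConditionalOracle μ (O i)) {x : Ω} {A : Finset Ω}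
    (hA : 0 < massOn μ (insert x A)) (u v : R) (f : R → ℝ) :
    (hitTest i x A u v).ev O f = mass μ x / massOn μ (insert x A) * f u
      + (1 - mass μ x / massOn μ (insert x A)) * f v := by
  rw [hitTest, ev_query_eq hO hA]
  have h : ∀ y ∈ insert x A, mass μ y / massOn μ (insert x A) *
      (Sampler.output (if some y = some x then u else v) : Sampler ι Ω R).ev O f
      = mass μ y / massOn μ (insert x A) * f v
        + if y = x then mass μ y / massOn μ (insert x A) * (f u - f v) else 0 := by
    intro y _
    by_cases hy : y = x
    · simp [hy]; ring
    · simp [hy]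
  rw [Finset.sum_congr rfl h, Finset.sum_add_distrib, ← Finset.sum_mul, ← Finset.sum_div]
  rw [Finset.sum_ite_eq_of_mem' _ _ _ (Finset.mem_insert_self x A)]
  change massOn μ _ / _ * _ + _ = _
  rw [div_self hA.ne']
  ring

/-- The indicator of the event that a sample from `A` together with `x` is `x`. -/
noncomputable def hitCoin (i : ι) (x : Ω) (A : Finset Ω) : Sampler ι Ω ℝ := hitTest i x A 1 0

theorem hitCoin_isCoin (hO : IsConditionalOracle μ (O i)) {x : Ω} {A : Finset Ω}
    (hA : 0 < massOn μ (insert x A)) :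
    Sampler.IsCoin O (hitCoin i x A) (mass μ x / massOn μ (insert x A)) :=
  fun f => ev_hitTest hO hA 1 0 f

/-- The indicator of the event that a sample from `A` together with `x` is in `A` and loses
against `x` in a second query. -/
noncomputable def pairCoin (i : ι) (x : Ω) (A : Finset Ω) : Sampler ι Ω ℝ :=
  .query i (insert x A) fun a => a.elim (.output 0) fun y =>
    if y ∈ A then hitCoin i x {y} else .output 0

theorem pairCoin_isCoin (hO : IsConditionalOracle μ (O i)) {x : Ω} {A : Finset Ω}
    (hA : 0 < massOn μ (insert x A)) :
    Sampler.IsCoin O (pairCoin i x A) ((∑ y ∈ A, share μ x y) / massOn μ (insert x A)) := by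
  intro f
  rw [pairCoin, ev_query_eq hO hA]
  have h : ∀ y ∈ insert x A, mass μ y / massOn μ (insert x A) *
      ((some y).elim (.output 0) fun y =>
        if y ∈ A then hitCoin i x {y} else .output 0 : Sampler ι Ω ℝ).ev O f
      = mass μ y / massOn μ (insert x A) * f 0
        + if y ∈ A then share μ x y / massOn μ (insert x A) * (f 1 - f 0) else 0 := by
    intro y _
    by_cases hy : y ∈ A
    · simp only [Option.elim, hy, if_true]
      rcases (mass_nonneg μ y).eq_or_lt with h0 | h0
      · simp [share, ← h0]
      · have hp : 0 < massOn μ {x, y} := h0.trans_le (mass_le_massOn μ (by simp))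
        rw [hitCoin_isCoin hO hp, share]
        ring
    · simp [hy]
  rw [Finset.sum_congr rfl h, Finset.sum_add_distrib, ← Finset.sum_mul, ← Finset.sum_div,
    Finset.sum_ite_mem, Finset.inter_eq_right.2 (Finset.subset_insert x A), ← Finset.sum_mul,
    ← Finset.sum_div]
  change massOn μ _ / _ * _ + _ = _
  rw [div_self hA.ne']
  ring

theorem hitTest_queriesAtMost (i : ι) (x : Ω) (A : Finset Ω) (u v : R) :
    (hitTest i x A u v).QueriesAtMost 1 := fun _ => trivial

theorem pairCoin_queriesAtMost (i : ι) (x : Ω) (A : Finset Ω) :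
    (pairCoin i x A).QueriesAtMost 2 := by
  intro a
  cases a with
  | none => trivial
  | some y =>
    simp only [Option.elim]
    split_ifs
    · exact hitTest_queriesAtMost i x {y} 1 0
    · trivial

end Mass

/-! ### Relative errors -/

section RelErr

/-- The relative error of the estimate `v` of `w`, truncated at `1`. -/
noncomputable def relErr (v w : ℝ) : ℝ := min 1 |v / w - 1|

theorem relErr_nonneg (v w : ℝ) : 0 ≤ relErr v w := le_min zero_le_one (abs_nonneg _)

theorem relErr_le_one (v w : ℝ) : relErr v w ≤ 1 := min_le_left _ _

/-- For v < 1/2 the truncation at 1 makes the bound trivial, so small or zero denominators need no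
separate control. -/
theorem relErr_div_le (u v : ℝ) : relErr (u / v) 1 ≤ 2 * (|u - 1| + |v - 1|) := by
  rw [relErr, div_one]
  rcases le_or_gt (1 / 2) v with hv | hv
  · refine (min_le_right _ _).trans ?_
    have hv0 : 0 < v := by linarith
    rw [div_sub_one hv0.ne', abs_div, abs_of_pos hv0, div_le_iff₀ hv0]
    have : |u - v| ≤ |u - 1| + |v - 1| := by
      have := abs_sub_le u 1 v
      rwa [abs_sub_comm 1 v] at this
    nlinarith [abs_nonneg (u - 1), abs_nonneg (v - 1)]
  · refine (min_le_left _ _).trans ?_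
    have : 1 / 2 < |v - 1| := by rw [abs_sub_comm]; exact lt_of_lt_of_le (by linarith) (le_abs_self _)
    linarith [abs_nonneg (u - 1)]

theorem relErr_div_sq_le (u v : ℝ) :
    relErr (u / v) 1 ^ 2 ≤ 8 * ((u - 1) ^ 2 + (v - 1) ^ 2) := by
  have h := relErr_div_le u v
  have h0 := relErr_nonneg (u / v) 1
  calc relErr (u / v) 1 ^ 2 ≤ (2 * (|u - 1| + |v - 1|)) ^ 2 := by gcongr
    _ ≤ 8 * (|u - 1| ^ 2 + |v - 1| ^ 2) := by nlinarith [sq_nonneg (|u - 1| - |v - 1|)]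
    _ = _ := by rw [sq_abs, sq_abs]

theorem relErr_mul_le (u v : ℝ) : relErr (u * v) 1 ≤ 2 * |u - 1| + relErr v 1 := by
  simp only [relErr, div_one]
  rcases le_or_gt |v - 1| 1 with hv | hv
  · rw [min_eq_right hv]
    refine (min_le_right _ _).trans ?_
    have h1 : u * v - 1 = (u - 1) * v + (v - 1) := by ring
    have hv2 : |v| ≤ 2 := by
      rw [abs_le] at hv ⊢
      constructor <;> linarith
    calc |u * v - 1| ≤ |(u - 1) * v| + |v - 1| := by rw [h1]; exact abs_add_le _ _
      _ ≤ _ := by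
        rw [abs_mul]
        nlinarith [abs_nonneg (u - 1)]
  · rw [min_eq_left hv.le]
    exact (min_le_left _ _).trans (by linarith [abs_nonneg (u - 1)])

end RelErr
end CondSampling

namespace CondSampling
open Finset

/-! ### One round of estimating the ratio of mass and win rate -/

section Ratio

variable {Ω : Type} [Fintype Ω] [DecidableEq Ω] {ι : Type} {O : ι → Oracle Ω} {i : ι} {μ : PMF Ω}

/-- An estimate of `mass μ x / winRate μ x`, from `n` samples each to compare `x` with a random
subset, and with the part of this subset that loses against `x`. -/
noncomputable def ratioRound (i : ι) (x : Ω) (n : ℕ) (P : ℝ) : Sampler ι Ω ℝ :=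
  .toss (bernoulliSubset P) fun A => ((hitCoin i x A).iterSum n).bind fun X =>
    ((pairCoin i x A).iterSum n).bind fun Y => .output (clamp P * X / Y)

theorem ratioRound_queriesAtMost (i : ι) (x : Ω) (n : ℕ) (P : ℝ) :
    (ratioRound i x n P).QueriesAtMost (3 * n) := by
  intro A
  rw [show 3 * n = n * 1 + (n * 2 + 0) by ring]
  exact ((hitTest_queriesAtMost i x A 1 0).iterSum n).bind fun X =>
    ((pairCoin_queriesAtMost i x A).iterSum n).bind fun Y => trivial

theorem bernoulliSubset_sq_dev (p : ℝ) (f : Ω → ℝ) :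
    ∑ A : Finset Ω, (bernoulliSubset p A).toReal * (∑ y ∈ A, f y - clamp p * ∑ y, f y) ^ 2
      = (clamp p - clamp p ^ 2) * ∑ y, f y * f y := by
  have h : ∀ A : Finset Ω,
      (bernoulliSubset p A).toReal * (∑ y ∈ A, f y - clamp p * ∑ y, f y) ^ 2
      = (bernoulliSubset p A).toReal * ((∑ y ∈ A, f y) * ∑ y ∈ A, f y)
        - 2 * (clamp p * ∑ y, f y) * ((bernoulliSubset p A).toReal * ∑ y ∈ A, f y)
        + (clamp p * ∑ y, f y) ^ 2 * (bernoulliSubset p A).toReal := fun A => by ring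
  rw [Finset.sum_congr rfl fun A _ => h A, Finset.sum_add_distrib, Finset.sum_sub_distrib,
    ← Finset.mul_sum, ← Finset.mul_sum, bernoulliSubset_mean, bernoulliSubset_mean_mul,
    Sampler.sum_toReal_pmf]
  ring

theorem sum_share_mul_mass_le (x : Ω) : ∑ y, share μ x y * mass μ y ≤ mass μ x := by
  refine (Finset.sum_le_sum fun y _ =>
    mul_le_mul_of_nonneg_right (share_le_left μ x y) (mass_nonneg μ y)).trans_eq ?_
  rw [← Finset.mul_sum, sum_mass, mul_one]

theorem sum_share_sq_le (x : Ω) :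
    ∑ y, share μ x y * share μ x y ≤ mass μ x * winRate μ x := by
  rw [winRate, Finset.mul_sum]
  exact Finset.sum_le_sum fun y _ =>
    mul_le_mul_of_nonneg_right (share_le_left μ x y) (share_nonneg μ x y)

/-- The expected squared error of `ratioRound` for a fixed subset. -/
theorem ev_ratioRound_fixed_le (hO : IsConditionalOracle μ (O i)) {x : Ω} (hx : 0 < mass μ x)
    {n : ℕ} (hn : 0 < n) {p : ℝ} (hp : 0 < p) (A : Finset Ω) :
    (((hitCoin i x A).iterSum n).bind fun X => ((pairCoin i x A).iterSum n).bind fun Y =>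
      .output (p * X / Y) : Sampler ι Ω ℝ).ev O
        (fun Q => relErr Q (mass μ x / winRate μ x) ^ 2)
      ≤ 8 * (massOn μ (insert x A) / (n * mass μ x)
        + ((∑ y ∈ A, share μ x y) * massOn μ (insert x A) / (n * (p * winRate μ x) ^ 2)
          + (∑ y ∈ A, share μ x y - p * winRate μ x) ^ 2 / (p * winRate μ x) ^ 2)) := by
  set m := mass μ x
  set S := winRate μ x
  set H := ∑ y ∈ A, share μ x y
  set b := massOn μ (insert x A)
  have hS : 0 < S := hx.trans_le (mass_le_winRate μ x)
  have hb : 0 < b := hx.trans_le (mass_le_massOn_insert μ x A)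
  have hn' : (0 : ℝ) < n := by exact_mod_cast hn
  simp only [Sampler.ev_bind, Sampler.ev_output]
  -- Normalize X and Y by n m / b and n p S / b; the unknown b cancels in the quotient. The first
  -- value is the mean of X, the second is the mean of Y with H replaced by its expectation p S.
  have hpt : ∀ X Y : ℝ, relErr (p * X / Y) (m / S) ^ 2
      ≤ 8 * (b / (n * m)) ^ 2 * (X - n * m / b) ^ 2
        + 8 * (b / (n * (p * S))) ^ 2 * (Y - n * (p * S) / b) ^ 2 := by
    intro X Y
    have h1 : relErr (p * X / Y) (m / S)
        = relErr ((X * (b / (n * m))) / (Y * (b / (n * (p * S))))) 1 := by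
      simp only [relErr]
      congr 3
      rcases eq_or_ne Y 0 with rfl | hY
      · simp
      · field_simp
    rw [h1]
    refine (relErr_div_sq_le _ _).trans_eq ?_
    have e1 : X * (b / (n * m)) - 1 = b / (n * m) * (X - n * m / b) := by field_simp
    have e2 : Y * (b / (n * (p * S))) - 1 = b / (n * (p * S)) * (Y - n * (p * S) / b) := by
      field_simp
    rw [e1, e2]
    ring
  have hY : ∀ X : ℝ, ((pairCoin i x A).iterSum n).ev O
      (fun Y => relErr (p * X / Y) (m / S) ^ 2)
      ≤ 8 * (b / (n * m)) ^ 2 * (X - n * m / b) ^ 2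
        + 8 * (H * b / (n * (p * S) ^ 2) + (H - p * S) ^ 2 / (p * S) ^ 2) := by
    intro X
    refine (Sampler.ev_mono O _ (hpt X)).trans ?_
    rw [Sampler.ev_add, Sampler.ev_const, Sampler.ev_const_mul]
    have h2 := (pairCoin_isCoin hO hb).ev_iterSum_sq_le n (n * (p * S) / b)
    have h3 := mul_le_mul_of_nonneg_left h2 (by positivity : 0 ≤ 8 * (b / (n * (p * S))) ^ 2)
    have h4 : 8 * (b / (n * (p * S))) ^ 2 * (n * (H / b) + (n * (H / b) - n * (p * S) / b) ^ 2)
        = 8 * (H * b / (n * (p * S) ^ 2) + (H - p * S) ^ 2 / (p * S) ^ 2) := by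
      field_simp
    rw [h4] at h3
    linarith
  refine (Sampler.ev_mono O _ hY).trans ?_
  rw [Sampler.ev_add, Sampler.ev_const, Sampler.ev_const_mul]
  have h2 := (hitCoin_isCoin hO hb).ev_iterSum_sq_le n (n * m / b)
  have h3 := mul_le_mul_of_nonneg_left h2 (by positivity : 0 ≤ 8 * (b / (n * m)) ^ 2)
  have h4 : 8 * (b / (n * m)) ^ 2 * (n * (m / b) + (n * (m / b) - n * m / b) ^ 2)
      = 8 * (b / (n * m)) := by
    field_simp
    ring
  rw [h4] at h3
  linarith

/-- Average the bound for fixed A. The lower bound on `P` controls the variance of the shares in A,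
at most (p - p²) m S, and yields `8 / k`. The upper bound keeps the expected mass of A within a
factor `L` of m, so that n samples leave a sampling error of order `L / n`. -/
theorem ev_ratioRound_le (hO : IsConditionalOracle μ (O i)) {x : Ω} (hx : 0 < mass μ x)
    {n : ℕ} (hn : 0 < n) {P k L : ℝ} (hk : 1 ≤ k) (hkP : k * mass μ x ≤ P * winRate μ x)
    (hPL : P ≤ L * mass μ x) :
    (ratioRound i x n P).ev O (fun Q => relErr Q (mass μ x / winRate μ x) ^ 2)
      ≤ 48 * L / n + 8 / k := by
  have hS : 0 < winRate μ x := hx.trans_le (mass_le_winRate μ x)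
  have hS1 := winRate_le_one μ x
  have hP : 0 < P := by
    by_contra h
    push Not at h
    nlinarith [mul_pos (zero_lt_one.trans_le hk) hx]
  have hp : 0 < clamp P := by rw [clamp_eq_min hP.le]; exact lt_min one_pos hP
  have hp1 := clamp_le_one P
  have hpP : clamp P ≤ P := by rw [clamp_eq_min hP.le]; exact min_le_right _ _
  -- Truncation does no harm: for `P ≥ 1` the subset is everything and its variance vanishes.
  have hpinv : (1 - clamp P) * P ≤ clamp P := by
    rw [clamp_eq_min hP.le]
    rcases le_total 1 P with h | h
    · simp [min_eq_left h]
    · rw [min_eq_right h]; nlinarith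
  have hn' : (0 : ℝ) < n := by exact_mod_cast hn
  rw [ratioRound, Sampler.ev_toss]
  have hb : ∀ A : Finset Ω, massOn μ (insert x A) ≤ ∑ y ∈ A, mass μ y + mass μ x :=
    fun A => massOn_insert_le μ x A
  have hw : ∀ A : Finset Ω, 0 ≤ (bernoulliSubset P A).toReal := fun A => ENNReal.toReal_nonneg
  have hH : ∀ A : Finset Ω, 0 ≤ ∑ y ∈ A, share μ x y :=
    fun A => Finset.sum_nonneg fun y _ => share_nonneg μ x y
  have hsum : ∑ A : Finset Ω, (bernoulliSubset P A).toReal *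
      (((hitCoin i x A).iterSum n).bind fun X => ((pairCoin i x A).iterSum n).bind fun Y =>
        .output (clamp P * X / Y) : Sampler ι Ω ℝ).ev O
          (fun Q => relErr Q (mass μ x / winRate μ x) ^ 2)
      ≤ ∑ A : Finset Ω,
        (8 / (n * mass μ x) * ((bernoulliSubset P A).toReal * ∑ y ∈ A, mass μ y)
        + 8 / n * (bernoulliSubset P A).toReal
        + 8 / (n * (clamp P * winRate μ x) ^ 2) *
          ((bernoulliSubset P A).toReal * ((∑ y ∈ A, share μ x y) * ∑ y ∈ A, mass μ y))
        + 8 * mass μ x / (n * (clamp P * winRate μ x) ^ 2) *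
          ((bernoulliSubset P A).toReal * ∑ y ∈ A, share μ x y)
        + 8 / (clamp P * winRate μ x) ^ 2 * ((bernoulliSubset P A).toReal *
          (∑ y ∈ A, share μ x y - clamp P * winRate μ x) ^ 2)) := by
    refine Finset.sum_le_sum fun A _ => ?_
    have h1 := mul_le_mul_of_nonneg_left (ev_ratioRound_fixed_le hO hx hn hp A) (hw A)
    refine h1.trans ?_
    have h2 : 8 * (massOn μ (insert x A) / (n * mass μ x)
        + ((∑ y ∈ A, share μ x y) * massOn μ (insert x A) / (n * (clamp P * winRate μ x) ^ 2)
          + (∑ y ∈ A, share μ x y - clamp P * winRate μ x) ^ 2 / (clamp P * winRate μ x) ^ 2))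
        ≤ 8 * ((∑ y ∈ A, mass μ y + mass μ x) / (n * mass μ x)
        + ((∑ y ∈ A, share μ x y) * (∑ y ∈ A, mass μ y + mass μ x) /
            (n * (clamp P * winRate μ x) ^ 2)
          + (∑ y ∈ A, share μ x y - clamp P * winRate μ x) ^ 2 / (clamp P * winRate μ x) ^ 2)) := by
      have := hb A
      have := hH A
      gcongr
    refine (mul_le_mul_of_nonneg_left h2 (hw A)).trans_eq ?_
    field_simp
    ring
  refine hsum.trans ?_
  simp only [Finset.sum_add_distrib, ← Finset.mul_sum]
  rw [bernoulliSubset_mean, bernoulliSubset_mean_mul, bernoulliSubset_mean,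
    Sampler.sum_toReal_pmf, sum_mass]
  change _ + _ + _ * (_ * (winRate μ x * _) + _) + _ * (_ * winRate μ x) + _ ≤ _
  have hdev := bernoulliSubset_sq_dev P (share μ x)
  change ∑ A : Finset Ω, _ * (_ - clamp P * winRate μ x) ^ 2 = _ at hdev
  rw [hdev]
  have hB := sum_share_mul_mass_le (μ := μ) x
  have hC := sum_share_sq_le (μ := μ) x
  set m := mass μ x
  set S := winRate μ x
  set p := clamp P
  have hpp : 0 ≤ p - p ^ 2 := by nlinarith
  have hPS : 0 < P * S := mul_pos hP hS
  have hmk : m / (P * S) ≤ 1 / k := by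
    rw [div_le_div_iff₀ hPS (by linarith)]
    linarith
  have hk1 : 1 / k ≤ 1 := by rw [div_le_one (by linarith)]; exact hk
  have hSL : 1 / S ≤ L := by
    rw [div_le_iff₀ hS]
    have h1 : m ≤ P * S := (le_mul_of_one_le_left hx.le hk).trans hkP
    have h2 : P * S ≤ L * m * S := mul_le_mul_of_nonneg_right hPL hS.le
    have h3 : 1 * m ≤ L * S * m := by linarith
    exact le_of_mul_le_mul_right h3 hx
  have hL1 : 1 ≤ L := by
    refine le_trans ?_ hSL
    rw [le_div_iff₀ hS]
    linarith
  have t1 : 8 / (n * m) * (p * 1) ≤ 8 * L / n := by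
    rw [div_mul_eq_mul_div, div_le_div_iff₀ (by positivity) hn']
    nlinarith [mul_le_mul_of_nonneg_right (hpP.trans hPL) hn'.le]
  have t2 : 8 / n * 1 ≤ 8 * L / n := by
    rw [mul_one]
    gcongr
    linarith
  have hpP2 : (p - p ^ 2) / p ^ 2 ≤ 1 / P := by
    rw [div_le_div_iff₀ (by positivity) hP]
    nlinarith
  have hppm : (p - p ^ 2) * m / (p * S) ^ 2 ≤ 1 / k * (1 / S) := by
    calc (p - p ^ 2) * m / (p * S) ^ 2 = (p - p ^ 2) / p ^ 2 * (m / S ^ 2) := by field_simp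
      _ ≤ 1 / P * (m / S ^ 2) := by gcongr
      _ = m / (P * S) * (1 / S) := by field_simp
      _ ≤ _ := by gcongr
  have t3 : 8 / (n * (p * S) ^ 2) * (p ^ 2 * (S * 1) + (p - p ^ 2) * ∑ y, share μ x y * mass μ y)
      ≤ 16 * L / n := by
    calc _ ≤ 8 / (n * (p * S) ^ 2) * (p ^ 2 * (S * 1) + (p - p ^ 2) * m) := by gcongr
      _ = 8 / n * (1 / S + (p - p ^ 2) * m / (p * S) ^ 2) := by field_simp
      _ ≤ 8 / n * (L + 1 * L) := by
        gcongr
        exact hppm.trans (by gcongr)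
      _ = _ := by ring
  have hpinv2 : 1 / p ≤ 1 + 1 / P := by
    have : 1 + 1 / P = (P + 1) / P := by field_simp
    rw [this, div_le_div_iff₀ hp hP]
    nlinarith
  have t4 : 8 * m / (n * (p * S) ^ 2) * (p * S) ≤ 16 * L / n := by
    calc _ = 8 / n * (1 / p * (m / S)) := by field_simp
      _ ≤ 8 / n * ((1 + 1 / P) * (m / S)) := by gcongr
      _ = 8 / n * (m / S + m / (P * S)) := by field_simp
      _ ≤ 8 / n * (L + L) := by
        have : m ≤ 1 := (mass_le_winRate μ x).trans hS1
        gcongr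
        · exact le_trans (by gcongr) hSL
        · linarith
      _ = _ := by ring
  have t5 : 8 / (p * S) ^ 2 * ((p - p ^ 2) * ∑ y, share μ x y * share μ x y) ≤ 8 / k := by
    calc _ ≤ 8 / (p * S) ^ 2 * ((p - p ^ 2) * (m * S)) := by gcongr
      _ = 8 * ((p - p ^ 2) * m / (p * S) ^ 2) * S := by ring
      _ ≤ 8 * (1 / k * (1 / S)) * S := by gcongr
      _ = _ := by field_simp
  have : 48 * L / n = 8 * L / n + 8 * L / n + 16 * L / n + 16 * L / n := by ring
  linarith

end Ratio
end CondSampling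

namespace CondSampling
open Finset

/-! ### Finding the inclusion probability, then a rough and a fine round -/

section RatioEstimate

variable {Ω : Type} [Fintype Ω] [DecidableEq Ω] {ι : Type} {O : ι → Oracle Ω} {i : ι} {μ : PMF Ω}

/-- A large random subset is unlikely to lose against `x`. -/
theorem ev_hitTest_bernoulli_le (hO : IsConditionalOracle μ (O i)) {x : Ω} (hx : 0 < mass μ x)
    {p : ℝ} (hp : 0 < p) (hp1 : p ≤ 1) :
    (Sampler.toss (bernoulliSubset p) fun A => hitTest i x A true false).ev O
      (fun r => if r then 1 else 0) ≤ 6 * mass μ x / (p * winRate μ x) := by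
  have hS : 0 < winRate μ x := hx.trans_le (mass_le_winRate μ x)
  have hc : clamp p = p := by rw [clamp_eq_min hp.le, min_eq_right hp1]
  rw [Sampler.ev_toss]
  have hpt : ∀ A : Finset Ω, (hitTest i x A true false).ev O (fun r => if r then 1 else 0)
      ≤ 4 / (p * winRate μ x) ^ 2 * (∑ y ∈ A, share μ x y - p * winRate μ x) ^ 2
        + 2 * mass μ x / (p * winRate μ x) := by
    intro A
    have hB : 0 < massOn μ (insert x A) := hx.trans_le (mass_le_massOn_insert μ x A)
    rw [ev_hitTest hO hB]
    simp only [if_true, Bool.false_eq_true, if_false, mul_one, mul_zero, add_zero]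
    set u := p * winRate μ x
    have hu : 0 < u := mul_pos hp hS
    have hHB : ∑ y ∈ A, share μ x y ≤ massOn μ (insert x A) :=
      (Finset.sum_le_sum fun y _ => share_le_right μ x y).trans (massOn_le_massOn_insert μ x A)
    set H := ∑ y ∈ A, share μ x y
    -- Chebyshev: if H is at least half of its mean u, the hit probability is at most 2m/u;
    -- otherwise the squared deviation pays for the trivial bound 1.
    rcases le_or_gt (u / 2) H with h | h
    · have h1 : mass μ x / massOn μ (insert x A) ≤ 2 * mass μ x / u := by
        rw [div_le_div_iff₀ hB hu]
        nlinarith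
      have : 0 ≤ 4 / u ^ 2 * (H - u) ^ 2 := by positivity
      linarith
    · have h1 : mass μ x / massOn μ (insert x A) ≤ 1 :=
        div_le_one_of_le₀ (mass_le_massOn_insert μ x A) hB.le
      have h2 : 1 ≤ 4 / u ^ 2 * (H - u) ^ 2 := by
        rw [div_mul_eq_mul_div, le_div_iff₀ (by positivity)]
        nlinarith
      have : 0 ≤ 2 * mass μ x / u := by positivity
      linarith
  have hdev := bernoulliSubset_sq_dev p (share μ x)
  rw [hc] at hdev
  change ∑ A : Finset Ω, _ * (_ - p * winRate μ x) ^ 2 = _ at hdev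
  calc _ ≤ ∑ A : Finset Ω, (4 / (p * winRate μ x) ^ 2 * ((bernoulliSubset p A).toReal *
          (∑ y ∈ A, share μ x y - p * winRate μ x) ^ 2)
          + 2 * mass μ x / (p * winRate μ x) * (bernoulliSubset p A).toReal) := by
        refine Finset.sum_le_sum fun A _ => ?_
        refine (mul_le_mul_of_nonneg_left (hpt A) ENNReal.toReal_nonneg).trans_eq ?_
        ring
    _ = 4 / (p * winRate μ x) ^ 2 * ((p - p ^ 2) * ∑ y, share μ x y * share μ x y)
          + 2 * mass μ x / (p * winRate μ x) := by
        rw [Finset.sum_add_distrib, ← Finset.mul_sum, ← Finset.mul_sum, hdev,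
          Sampler.sum_toReal_pmf, mul_one]
    _ ≤ 4 / (p * winRate μ x) ^ 2 * (p * (mass μ x * winRate μ x))
          + 2 * mass μ x / (p * winRate μ x) := by
        have h1 := sum_share_sq_le (μ := μ) x
        have h2 : 0 ≤ mass μ x * winRate μ x := by positivity
        have h3 : p - p ^ 2 ≤ p := by nlinarith
        have h4 : 0 ≤ ∑ y, share μ x y * share μ x y :=
          Finset.sum_nonneg fun y _ => mul_self_nonneg _
        gcongr
    _ = _ := by
        field_simp
        ring

/-- A small random subset is unlikely to win against `x`. -/
theorem ev_not_hitTest_bernoulli_le (hO : IsConditionalOracle μ (O i)) {x : Ω} (hx : 0 < mass μ x)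
    {p : ℝ} (hp : 0 < p) (hp1 : p ≤ 1) :
    (Sampler.toss (bernoulliSubset p) fun A => hitTest i x A true false).ev O
      (fun r => if r then 0 else 1) ≤ p / mass μ x := by
  have hc : clamp p = p := by rw [clamp_eq_min hp.le, min_eq_right hp1]
  rw [Sampler.ev_toss]
  have hpt : ∀ A : Finset Ω, (hitTest i x A true false).ev O (fun r => if r then 0 else 1)
      ≤ 1 / mass μ x * ∑ y ∈ A, mass μ y := by
    intro A
    have hB : 0 < massOn μ (insert x A) := hx.trans_le (mass_le_massOn_insert μ x A)
    rw [ev_hitTest hO hB]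
    simp only [if_true, Bool.false_eq_true, if_false, mul_one, mul_zero, zero_add]
    have h1 : massOn μ (insert x A) ≤ ∑ y ∈ A, mass μ y + mass μ x := massOn_insert_le μ x A
    have h0 : 0 ≤ ∑ y ∈ A, mass μ y := massOn_nonneg μ A
    rw [one_sub_div hB.ne', div_mul_eq_mul_div, one_mul, div_le_div_iff₀ hB hx]
    nlinarith [mass_le_massOn_insert μ x A]
  calc _ ≤ ∑ A : Finset Ω, 1 / mass μ x * ((bernoulliSubset p A).toReal * ∑ y ∈ A, mass μ y) := by
        refine Finset.sum_le_sum fun A _ => ?_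
        refine (mul_le_mul_of_nonneg_left (hpt A) ENNReal.toReal_nonneg).trans_eq ?_
        ring
    _ = _ := by
        rw [← Finset.mul_sum, bernoulliSubset_mean, sum_mass, hc]
        ring

/-- The inclusion probabilities among which the search takes place. -/
noncomputable def scale (j : ℕ) : ℝ := (1 / 2) ^ (j - 1)

theorem scale_pos (j : ℕ) : 0 < scale j := by unfold scale; positivity

theorem scale_le_one (j : ℕ) : scale j ≤ 1 := pow_le_one₀ (by norm_num) (by norm_num)

theorem scale_antitone : Antitone scale := fun _ _ h =>
  pow_le_pow_of_le_one (by norm_num) (by norm_num) (by omega)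

theorem scale_le_two_mul (j : ℕ) : scale j ≤ 2 * scale (j + 1) := by
  unfold scale
  -- Truncated subtraction makes `scale 0` and `scale 1` both equal to 1.
  cases j with
  | zero => norm_num
  | succ j =>
    rw [show j + 1 + 1 - 1 = (j + 1 - 1) + 1 by omega, pow_succ]
    linarith

/-- Test whether a random subset with inclusion probability `scale j` loses against `x`. -/
noncomputable def scaleTest (i : ι) (x : Ω) (j : ℕ) : Sampler ι Ω Bool :=
  if j = 0 then .output false
  else .toss (bernoulliSubset (scale j)) fun A => hitTest i x A true false

theorem scaleTest_queriesAtMost (i : ι) (x : Ω) (j : ℕ) : (scaleTest i x j).QueriesAtMost 1 := by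
  unfold scaleTest
  split_ifs
  · trivial
  · exact fun A => hitTest_queriesAtMost i x A true false

open scoped Classical in
-- Let b be the first positive scale at which x reliably wins, and a the last at which it reliably
-- loses. Anything in between satisfies both inequalities, since adjacent scales differ by a factor
-- of at most 2.
theorem ev_search_scaleTest_le (hO : IsConditionalOracle μ (O i)) {x : Ω} (hx : 0 < mass μ x)
    {M : ℕ} (hM1 : 1 ≤ M) (hM : 50 * scale M ≤ mass μ x) (R : ℕ) :
    (search M (scaleTest i x) (2 * R) (fun _ => 0) []).ev O
      (fun j => if mass μ x ≤ 100 * scale j ∧ scale j * winRate μ x ≤ 600 * mass μ x then 0 else 1)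
      ≤ (M + 1) * (91 / 100) ^ R := by
  have hS : 0 < winRate μ x := hx.trans_le (mass_le_winRate μ x)
  have hS1 := winRate_le_one μ x
  obtain ⟨b, ⟨hb1, hb⟩, hbmin⟩ : ∃ b, (1 ≤ b ∧ 50 * scale b ≤ mass μ x) ∧
      ∀ j < b, ¬ (1 ≤ j ∧ 50 * scale j ≤ mass μ x) := by
    have h : ∃ b, 1 ≤ b ∧ 50 * scale b ≤ mass μ x := ⟨M, hM1, hM⟩
    exact ⟨Nat.find h, Nat.find_spec h, fun j => Nat.find_min h⟩
  have hbM : b ≤ M := not_lt.1 fun h => hbmin M h ⟨hM1, hM⟩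
  -- The artificial candidate 0, where the test always says no, ensures that a exists. The factors
  -- 300 here and 50 above make both error bounds at most 1/50.
  let P : ℕ → Prop := fun j => j = 0 ∨ 300 * mass μ x ≤ scale j * winRate μ x
  set a := Nat.findGreatest P M with ha
  have hPa : P a := Nat.findGreatest_spec (P := P) (m := 0) (by omega) (Or.inl rfl)
  have hab : a < b := by
    rcases hPa with h | h
    · omega
    · by_contra hlt
      push Not at hlt
      have h1 := scale_antitone hlt
      have h2 : scale a * winRate μ x ≤ scale a := mul_le_of_le_one_right (scale_pos a).le hS1
      linarith
  have haM : ¬ P (a + 1) := Nat.findGreatest_is_greatest (Nat.lt_succ_self _) (by omega)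
  have hno : ∀ j ≤ a, (scaleTest i x j).ev O (fun r => if r then 1 else 0) ≤ 1 / 50 := by
    intro j hj
    unfold scaleTest
    split_ifs with h0
    · simp
    · refine (ev_hitTest_bernoulli_le hO hx (scale_pos j) (scale_le_one j)).trans ?_
      have h1 : 300 * mass μ x ≤ scale a * winRate μ x := hPa.resolve_left (by omega)
      have h2 := mul_le_mul_of_nonneg_right (scale_antitone hj) hS.le
      rw [div_le_div_iff₀ (mul_pos (scale_pos j) hS) (by norm_num)]
      linarith
  have hyes : ∀ j, b ≤ j → j ≤ M →
      (scaleTest i x j).ev O (fun r => if r then 0 else 1) ≤ 1 / 50 := by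
    intro j hj _
    unfold scaleTest
    rw [if_neg (by omega)]
    refine (ev_not_hitTest_bernoulli_le hO hx (scale_pos j) (scale_le_one j)).trans ?_
    have := scale_antitone hj
    rw [div_le_div_iff₀ hx (by norm_num)]
    linarith
  have hsearch := ev_search_le O M (scaleTest i x) hab hbM hno hyes R (2 * R) (fun _ => 0) [] (by simp)
  have hW : weight (range (M + 1)) (fun _ => 0) = M + 1 := by simp [weight]
  rw [hW] at hsearch
  simp only [add_zero, pow_zero, mul_one, List.countP_nil, one_mul] at hsearch
  refine le_trans (Sampler.ev_mono O _ fun j => ?_) hsearch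
  by_cases hj : a ≤ j ∧ j ≤ b
  · rw [if_pos, if_pos hj]
    constructor
    · refine le_trans ?_ (mul_le_mul_of_nonneg_left (scale_antitone hj.2) (by norm_num))
      have h2 := scale_le_two_mul (b - 1)
      rw [Nat.sub_add_cancel hb1] at h2
      rcases hb1.eq_or_lt with h | h
      · rw [← h]
        have : mass μ x ≤ 1 := (mass_le_winRate μ x).trans hS1
        norm_num [scale]
        linarith
      · have := hbmin (b - 1) (by omega)
        simp only [not_and, not_le] at this
        linarith [this (by omega)]
    · have h1 := (scale_antitone hj.1).trans (scale_le_two_mul a)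
      have h2 : scale (a + 1) * winRate μ x < 300 * mass μ x := not_le.1 fun h => haM (Or.inr h)
      nlinarith [mul_le_mul_of_nonneg_right h1 hS.le]
  · rw [if_neg hj]
    split_ifs <;> norm_num

/-- An estimate of `mass μ x / winRate μ x` with relative error of the order of `δ`: a search for
the right inclusion probability, a rough estimate, and a fine estimate. -/
noncomputable def ratioEstimate (i : ι) (x : Ω) (δ : ℝ) (M R n₁ n₂ : ℕ) : Sampler ι Ω ℝ :=
  (search M (scaleTest i x) (2 * R) (fun _ => 0) []).bind fun j =>
    (ratioRound i x n₁ (12800 / δ ^ 2 * scale j)).bind fun Q =>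
      ratioRound i x n₂ (32 / δ ^ 2 * Q)

theorem ratioEstimate_queriesAtMost (i : ι) (x : Ω) (δ : ℝ) (M R n₁ n₂ : ℕ) :
    (ratioEstimate i x δ M R n₁ n₂).QueriesAtMost (2 * R + (3 * n₁ + 3 * n₂)) := by
  have h := search_queriesAtMost M (scaleTest_queriesAtMost i x) (2 * R) (fun _ => 0) []
  rw [mul_one] at h
  exact h.bind fun j => (ratioRound_queriesAtMost i x n₁ _).bind
    fun Q => ratioRound_queriesAtMost i x n₂ _

/-- A `Q` within a factor of two of m/S fixes the inclusion probability up to constants. So k can be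
of order 1/δ² while L is only of order 1/δ³, and n of order 1/δ⁵ gives a mean squared error of δ².
-/
theorem ev_fine_ratioRound_le (hO : IsConditionalOracle μ (O i)) {x : Ω} (hx : 0 < mass μ x)
    {δ : ℝ} (hδ : 0 < δ) (hδ1 : δ ≤ 1) (hδS : δ / 2 ≤ winRate μ x) {n : ℕ}
    (hn : 9216 / δ ^ 5 ≤ n) {Q : ℝ} (hQ : relErr Q (mass μ x / winRate μ x) ≤ 1 / 2) :
    (ratioRound i x n (32 / δ ^ 2 * Q)).ev O (fun v => relErr v (mass μ x / winRate μ x)) ≤ δ := by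
  have hS : 0 < winRate μ x := hx.trans_le (mass_le_winRate μ x)
  have hn' : (0 : ℝ) < n := lt_of_lt_of_le (by positivity) hn
  set w := mass μ x / winRate μ x with hw
  have hw0 : 0 < w := div_pos hx hS
  have hwS : w * winRate μ x = mass μ x := div_mul_cancel₀ _ hS.ne'
  have hQ' : |Q / w - 1| ≤ 1 / 2 := by
    rcases min_le_iff.1 hQ with h | h
    · norm_num at h
    · exact h
  rw [abs_le] at hQ'
  have hQ1 : w / 2 ≤ Q := by
    have : 1 / 2 ≤ Q / w := by linarith
    rw [le_div_iff₀ hw0] at this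
    linarith
  have hQ2 : Q ≤ 3 / 2 * w := by
    have : Q / w ≤ 3 / 2 := by linarith
    rwa [div_le_iff₀ hw0] at this
  have hV := ev_ratioRound_le hO hx (n := n) (by exact_mod_cast hn') (P := 32 / δ ^ 2 * Q)
    (k := 16 / δ ^ 2) (L := 96 / δ ^ 3)
    (by rw [le_div_iff₀ (by positivity)]; nlinarith)
    (by
      calc 16 / δ ^ 2 * mass μ x = 32 / δ ^ 2 * (w / 2) * winRate μ x := by rw [← hwS]; ring
        _ ≤ _ := by gcongr)
    (by
      calc 32 / δ ^ 2 * Q ≤ 32 / δ ^ 2 * (3 / 2 * w) := by gcongr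
        _ = 48 / δ ^ 2 * mass μ x * (1 / winRate μ x) := by rw [hw]; ring
        _ ≤ 48 / δ ^ 2 * mass μ x * (1 / (δ / 2)) := by gcongr
        _ = _ := by field_simp; norm_num)
  rw [← hw] at hV
  have hV2 : 48 * (96 / δ ^ 3) / n + 8 / (16 / δ ^ 2) ≤ δ ^ 2 := by
    have : 48 * (96 / δ ^ 3) / n ≤ δ ^ 2 / 2 := by
      rw [div_le_iff₀ hn']
      calc 48 * (96 / δ ^ 3) = δ ^ 2 / 2 * (9216 / δ ^ 5) := by field_simp; norm_num
        _ ≤ _ := by gcongr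
    have h2 : 8 / (16 / δ ^ 2) = δ ^ 2 / 2 := by field_simp; norm_num
    linarith
  -- AM-GM in place of Cauchy-Schwarz passes from second to first moments.
  have hpt : ∀ v, relErr v w ≤ 1 / (2 * δ) * relErr v w ^ 2 + δ / 2 := by
    intro v
    have : 1 / (2 * δ) * relErr v w ^ 2 + δ / 2 - relErr v w
        = (relErr v w - δ) ^ 2 / (2 * δ) := by field_simp; ring
    have h0 : 0 ≤ (relErr v w - δ) ^ 2 / (2 * δ) := by positivity
    linarith
  refine (Sampler.ev_mono O _ hpt).trans ?_
  rw [Sampler.ev_add, Sampler.ev_const, Sampler.ev_const_mul]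
  have := mul_le_mul_of_nonneg_left (hV.trans hV2) (by positivity : 0 ≤ 1 / (2 * δ))
  have h3 : 1 / (2 * δ) * δ ^ 2 = δ / 2 := by field_simp
  linarith

open scoped Classical in
-- The window left by the search costs another factor 1/δ in L relative to k. Here a mean squared
-- error of δ/4 is enough, as Markov bounds the probability of an error above 1/2 by four times
-- that; hence n of order 1/δ⁴ suffices.
theorem ev_rough_ratioRound_le (hO : IsConditionalOracle μ (O i)) {x : Ω} (hx : 0 < mass μ x)
    {δ : ℝ} (hδ : 0 < δ) (hδ1 : δ ≤ 1) (hδS : δ / 2 ≤ winRate μ x) {n : ℕ}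
    (hn : 5898240000 / δ ^ 4 ≤ n) {p : ℝ} (hp1 : mass μ x ≤ 100 * p)
    (hp2 : p * winRate μ x ≤ 600 * mass μ x) :
    (ratioRound i x n (12800 / δ ^ 2 * p)).ev O
      (fun v => if relErr v (mass μ x / winRate μ x) ≤ 1 / 2 then 0 else 1) ≤ δ := by
  have hS : 0 < winRate μ x := hx.trans_le (mass_le_winRate μ x)
  have hn' : (0 : ℝ) < n := lt_of_lt_of_le (by positivity) hn
  have hV := ev_ratioRound_le hO hx (n := n) (by exact_mod_cast hn') (P := 12800 / δ ^ 2 * p)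
    (k := 64 / δ) (L := 15360000 / δ ^ 3)
    (by rw [le_div_iff₀ hδ]; linarith)
    (by
      calc 64 / δ * mass μ x = 12800 / δ ^ 2 * (mass μ x / 100) * (δ / 2) := by field_simp; norm_num
        _ ≤ _ := by
            have hp0 : 0 ≤ p := by linarith
            have hp' : mass μ x / 100 ≤ p := by linarith
            exact mul_le_mul (mul_le_mul_of_nonneg_left hp' (by positivity)) hδS (by positivity)
              (by positivity))
    (by
      have hp3 : p ≤ 600 * mass μ x / winRate μ x := by rwa [le_div_iff₀ hS]
      calc 12800 / δ ^ 2 * p ≤ 12800 / δ ^ 2 * (600 * mass μ x / winRate μ x) := by gcongr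
        _ ≤ 12800 / δ ^ 2 * (600 * mass μ x / (δ / 2)) := by gcongr
        _ = _ := by field_simp; norm_num)
  have hV2 : 48 * (15360000 / δ ^ 3) / n + 8 / (64 / δ) ≤ δ / 4 := by
    have : 48 * (15360000 / δ ^ 3) / n ≤ δ / 8 := by
      rw [div_le_iff₀ hn']
      calc 48 * (15360000 / δ ^ 3) = δ / 8 * (5898240000 / δ ^ 4) := by field_simp; norm_num
        _ ≤ _ := by gcongr
    have h2 : 8 / (64 / δ) = δ / 8 := by field_simp; norm_num
    linarith
  have hpt : ∀ v, (if relErr v (mass μ x / winRate μ x) ≤ 1 / 2 then (0 : ℝ) else 1)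
      ≤ 4 * relErr v (mass μ x / winRate μ x) ^ 2 := by
    intro v
    split_ifs with h
    · positivity
    · push Not at h
      nlinarith
  refine (Sampler.ev_mono O _ hpt).trans ?_
  rw [Sampler.ev_const_mul]
  linarith

/-- One δ each for a failed search, a failed rough round, and the error of the fine round. -/
theorem ev_ratioEstimate_le (hO : IsConditionalOracle μ (O i)) {x : Ω}
    {δ : ℝ} (hδ : 0 < δ) (hδ1 : δ ≤ 1) (hδS : δ / 2 ≤ winRate μ x) {M R n₁ n₂ : ℕ}
    (hM1 : 1 ≤ M) (hM : 100 * Fintype.card Ω * scale M ≤ δ) (hR : (M + 1) * (91 / 100) ^ R ≤ δ)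
    (hn₁ : 5898240000 / δ ^ 4 ≤ n₁) (hn₂ : 9216 / δ ^ 5 ≤ n₂) :
    (ratioEstimate i x δ M R n₁ n₂).ev O (fun v => relErr v (mass μ x / winRate μ x)) ≤ 3 * δ := by
  have hx : 0 < mass μ x := mass_pos_of_winRate_pos μ (by linarith)
  have hMx : 50 * scale M ≤ mass μ x := by
    have h1 := hδS.trans (winRate_le_card_mul μ x)
    have hc : (0 : ℝ) < Fintype.card Ω := by exact_mod_cast Fintype.card_pos_iff.2 ⟨x⟩
    refine le_of_mul_le_mul_left ?_ hc
    linarith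
  rw [ratioEstimate, Sampler.ev_bind]
  have hle : ∀ j, ((ratioRound i x n₁ (12800 / δ ^ 2 * scale j)).bind fun Q =>
      ratioRound i x n₂ (32 / δ ^ 2 * Q)).ev O (fun v => relErr v (mass μ x / winRate μ x)) ≤ 1 :=
    fun j => Sampler.ev_le_of_le O _ fun v => relErr_le_one _ _
  refine (Sampler.ev_le_of_good O _ (fun j => mass μ x ≤ 100 * scale j ∧
    scale j * winRate μ x ≤ 600 * mass μ x) (δ := δ) (η := δ + δ) (by linarith)
    ((ev_search_scaleTest_le hO hx hM1 hMx R).trans hR) hle ?_).trans_eq (by ring)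
  rintro j ⟨hj1, hj2⟩
  rw [Sampler.ev_bind]
  refine Sampler.ev_le_of_good O _
    (fun Q => relErr Q (mass μ x / winRate μ x) ≤ 1 / 2) hδ.le
    (ev_rough_ratioRound_le hO hx hδ hδ1 hδS hn₁ hj1 hj2)
    (fun Q => Sampler.ev_le_of_le O _ fun v => relErr_le_one _ _) ?_
  exact fun Q hQ => ev_fine_ratioRound_le hO hx hδ hδ1 hδS hn₂ hQ

end RatioEstimate
end CondSampling

namespace CondSampling
open Finset

/-! ### Estimating point masses -/

section MassEstimate

variable {Ω : Type} [Fintype Ω] [DecidableEq Ω] {ι : Type} {O : ι → Oracle Ω} {i j : ι} {μ τ : PMF Ω}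

/-- The sample sizes used by the estimators. -/
structure Parameters where
  /-- the accuracy -/
  δ : ℝ
  /-- the number of samples for the win rate -/
  nwin : ℕ
  /-- the largest candidate of the search -/
  M : ℕ
  /-- half the number of tests in the search -/
  R : ℕ
  /-- the number of samples for the rough estimate -/
  n₁ : ℕ
  /-- the number of samples for the fine estimate -/
  n₂ : ℕ

/-- The sample sizes are large enough for a domain of size `N`. -/
structure Parameters.Suitable (p : Parameters) (N : ℕ) : Prop where
  pos : 0 < p.δ
  le_one : p.δ ≤ 1
  le_nwin : 2 / p.δ ^ 3 ≤ p.nwin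
  one_le_M : 1 ≤ p.M
  scale_le : 100 * N * scale p.M ≤ p.δ
  le_R : (p.M + 1) * (91 / 100) ^ p.R ≤ p.δ
  le_n₁ : 5898240000 / p.δ ^ 4 ≤ p.n₁
  le_n₂ : 9216 / p.δ ^ 5 ≤ p.n₂

/-- An estimate of `mass μ x`, which is `0` if the win rate of `x` appears to be small. -/
noncomputable def massEstimate (p : Parameters) (i : ι) (x : Ω) : Sampler ι Ω ℝ :=
  ((pairCoin i x univ).iterSum p.nwin).bind fun Y =>
    if Y / p.nwin < p.δ then .output 0
    else (ratioEstimate i x p.δ p.M p.R p.n₁ p.n₂).bind fun Q => .output (Y / p.nwin * Q)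

/-- A bound for the number of queries made by `massEstimate`. -/
def Parameters.queries (p : Parameters) : ℕ :=
  p.nwin * 2 + (2 * p.R + (3 * p.n₁ + 3 * p.n₂))

theorem massEstimate_queriesAtMost (p : Parameters) (i : ι) (x : Ω) :
    (massEstimate p i x).QueriesAtMost p.queries := by
  refine ((pairCoin_queriesAtMost i x univ).iterSum p.nwin).bind fun Y => ?_
  split_ifs
  · trivial
  · exact (ratioEstimate_queriesAtMost i x p.δ p.M p.R p.n₁ p.n₂).bind (q' := 0) fun Q => trivial

theorem ev_winRate_estimate_le (hO : IsConditionalOracle μ (O i)) (x : Ω) {n : ℕ} (hn : 0 < n) :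
    ((pairCoin i x univ).iterSum n).ev O (fun Y => (Y / n - winRate μ x) ^ 2)
      ≤ winRate μ x / n := by
  have hn' : (0 : ℝ) < n := by exact_mod_cast hn
  have hu : insert x (univ : Finset Ω) = univ := Finset.insert_eq_of_mem (Finset.mem_univ x)
  have hB : massOn μ (insert x (univ : Finset Ω)) = 1 := by rw [hu]; exact sum_mass μ
  have hc := pairCoin_isCoin hO (x := x) (A := univ) (by rw [hB]; exact one_pos)
  rw [hB, div_one] at hc
  have h := hc.ev_iterSum_sq_le n (n * winRate μ x)
  change _ ≤ n * winRate μ x + (n * winRate μ x - n * winRate μ x) ^ 2 at h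
  have hf : (fun Y : ℝ => (Y / n - winRate μ x) ^ 2)
      = fun Y => 1 / (n : ℝ) ^ 2 * (Y - n * winRate μ x) ^ 2 := by
    funext Y
    field_simp
  rw [hf, Sampler.ev_const_mul]
  refine (mul_le_mul_of_nonneg_left h (by positivity)).trans_eq ?_
  field_simp
  ring

/-- The relative variance is at most 1/(nS), which is at most δ² for these `n` and S; AM-GM then
bounds the first moment. -/
theorem ev_abs_winRate_estimate_le (hO : IsConditionalOracle μ (O i)) (x : Ω) {n : ℕ} {δ : ℝ}
    (hδ : 0 < δ) (hn : 2 / δ ^ 3 ≤ n) (hS : δ / 2 ≤ winRate μ x) :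
    ((pairCoin i x univ).iterSum n).ev O (fun Y => |Y / n / winRate μ x - 1|) ≤ δ := by
  have hn' : (0 : ℝ) < n := lt_of_lt_of_le (by positivity) hn
  have hS0 : 0 < winRate μ x := by linarith
  have h := ev_winRate_estimate_le hO x (n := n) (by exact_mod_cast hn')
  have hpt : ∀ Y : ℝ, |Y / n / winRate μ x - 1|
      ≤ 1 / (2 * δ * winRate μ x ^ 2) * (Y / n - winRate μ x) ^ 2 + δ / 2 := by
    intro Y
    have e : 1 / (2 * δ * winRate μ x ^ 2) * (Y / n - winRate μ x) ^ 2 + δ / 2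
        = (|Y / n / winRate μ x - 1| ^ 2 + δ ^ 2) / (2 * δ) := by
      rw [sq_abs]
      field_simp
    rw [e, le_div_iff₀ (by positivity)]
    nlinarith [sq_nonneg (|Y / n / winRate μ x - 1| - δ)]
  refine (Sampler.ev_mono O _ hpt).trans ?_
  rw [Sampler.ev_add, Sampler.ev_const, Sampler.ev_const_mul]
  have h1 := mul_le_mul_of_nonneg_left h (by positivity : 0 ≤ 1 / (2 * δ * winRate μ x ^ 2))
  have h2 : 1 / (2 * δ * winRate μ x ^ 2) * (winRate μ x / n) ≤ δ / 2 := by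
    calc _ = 1 / (2 * δ * winRate μ x * n) := by field_simp
      _ ≤ 1 / (2 * δ * (δ / 2) * (2 / δ ^ 3)) := by gcongr
      _ = _ := by field_simp
  linarith

theorem relErr_mul_of_div {s Q m S : ℝ} (hS : S ≠ 0) (hm : m ≠ 0) :
    relErr (s * Q) m ≤ 2 * |s / S - 1| + relErr Q (m / S) := by
  have h := relErr_mul_le (s / S) (Q / (m / S))
  have e1 : relErr (s / S * (Q / (m / S))) 1 = relErr (s * Q) m := by
    unfold relErr
    congr 3
    field_simp
  have e2 : relErr (Q / (m / S)) 1 = relErr Q (m / S) := by simp [relErr]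
  rwa [e1, e2] at h

theorem ev_ratioEstimate_mul_le (hO : IsConditionalOracle μ (O i)) (x : Ω) {p : Parameters}
    (hp : p.Suitable (Fintype.card Ω)) (hS : p.δ / 2 ≤ winRate μ x) (s : ℝ) :
    ((ratioEstimate i x p.δ p.M p.R p.n₁ p.n₂).bind fun Q => .output (s * Q) :
      Sampler ι Ω ℝ).ev O (fun v => relErr v (mass μ x))
      ≤ 2 * |s / winRate μ x - 1| + 3 * p.δ := by
  have hδ := hp.pos
  have hS0 : 0 < winRate μ x := by linarith
  have hx := mass_pos_of_winRate_pos μ hS0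
  simp only [Sampler.ev_bind, Sampler.ev_output]
  refine (Sampler.ev_mono O _ fun Q => relErr_mul_of_div hS0.ne' hx.ne').trans ?_
  rw [Sampler.ev_add, Sampler.ev_const]
  linarith [ev_ratioEstimate_le hO hδ hp.le_one hS hp.one_le_M hp.scale_le hp.le_R hp.le_n₁ hp.le_n₂]

open scoped Classical in
/-- Whenever `massEstimate` does not output `0`, it is accurate with high probability. -/
theorem ev_massEstimate_or_zero_le (hO : IsConditionalOracle μ (O i)) (x : Ω) {p : Parameters}
    (hp : p.Suitable (Fintype.card Ω)) :
    (massEstimate p i x).ev O (fun v => if v = 0 then 0 else relErr v (mass μ x)) ≤ 5 * p.δ := by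
  have hδ := hp.pos
  have hδ1 := hp.le_one
  have hn' : (0 : ℝ) < p.nwin := lt_of_lt_of_le (by positivity) hp.le_nwin
  rw [massEstimate, Sampler.ev_bind]
  rcases lt_or_ge (winRate μ x) (p.δ / 2) with hS | hS
  · have hpt : ∀ Y : ℝ, (if Y / p.nwin < p.δ then (.output 0 : Sampler ι Ω ℝ)
        else (ratioEstimate i x p.δ p.M p.R p.n₁ p.n₂).bind fun Q =>
          .output (Y / p.nwin * Q)).ev O (fun v => if v = 0 then 0 else relErr v (mass μ x))
        -- With a win rate below δ/2, a nonzero output requires a deviation of at least δ/2, which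
        -- Chebyshev makes unlikely.
        ≤ 4 / p.δ ^ 2 * (Y / p.nwin - winRate μ x) ^ 2 := by
      intro Y
      split_ifs with h
      · simp only [Sampler.ev_output, if_true]
        positivity
      · push Not at h
        refine (Sampler.ev_le_of_le O _ (c := 1) fun v => ?_).trans ?_
        · split_ifs
          · exact zero_le_one
          · exact relErr_le_one _ _
        · rw [div_mul_eq_mul_div, le_div_iff₀ (by positivity)]
          nlinarith
    refine (Sampler.ev_mono O _ hpt).trans ?_
    rw [Sampler.ev_const_mul]
    have h := ev_winRate_estimate_le hO x (n := p.nwin) (by exact_mod_cast hn')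
    calc _ ≤ 4 / p.δ ^ 2 * (winRate μ x / p.nwin) := by gcongr
      _ ≤ 4 / p.δ ^ 2 * (p.δ / 2 / (2 / p.δ ^ 3)) := by
          have := winRate_nonneg μ x
          have := hp.le_nwin
          gcongr
      _ = p.δ * p.δ := by field_simp; norm_num
      _ ≤ _ := by nlinarith
  · have hpt : ∀ Y : ℝ, (if Y / p.nwin < p.δ then (.output 0 : Sampler ι Ω ℝ)
        else (ratioEstimate i x p.δ p.M p.R p.n₁ p.n₂).bind fun Q =>
          .output (Y / p.nwin * Q)).ev O (fun v => if v = 0 then 0 else relErr v (mass μ x))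
        ≤ 2 * |Y / p.nwin / winRate μ x - 1| + 3 * p.δ := by
      intro Y
      split_ifs with h
      · simp only [Sampler.ev_output, if_true]
        positivity
      · refine le_trans (Sampler.ev_mono O _ fun v => ?_) (ev_ratioEstimate_mul_le hO x hp hS _)
        split_ifs
        · exact relErr_nonneg _ _
        · exact le_rfl
    refine (Sampler.ev_mono O _ hpt).trans ?_
    rw [Sampler.ev_add, Sampler.ev_const, Sampler.ev_const_mul]
    linarith [ev_abs_winRate_estimate_le hO x hδ hp.le_nwin hS]

/-- Falling below the threshold δ with a win rate of at least 2δ means a relative deviation of at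
least 1/2, so the error of the win rate estimate also covers this case. -/
theorem ev_massEstimate_le (hO : IsConditionalOracle μ (O i)) {x : Ω} {p : Parameters}
    (hp : p.Suitable (Fintype.card Ω)) (hS : 2 * p.δ ≤ winRate μ x) :
    (massEstimate p i x).ev O (fun v => relErr v (mass μ x)) ≤ 7 * p.δ := by
  have hδ := hp.pos
  have hS0 : 0 < winRate μ x := by linarith
  have hS2 : p.δ / 2 ≤ winRate μ x := by linarith
  rw [massEstimate, Sampler.ev_bind]
  have hpt : ∀ Y : ℝ, (if Y / p.nwin < p.δ then (.output 0 : Sampler ι Ω ℝ)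
      else (ratioEstimate i x p.δ p.M p.R p.n₁ p.n₂).bind fun Q =>
        .output (Y / p.nwin * Q)).ev O (fun v => relErr v (mass μ x))
      ≤ 4 * |Y / p.nwin / winRate μ x - 1| + 3 * p.δ := by
    intro Y
    have h0 := abs_nonneg (Y / p.nwin / winRate μ x - 1)
    split_ifs with h
    · have h1 : Y / p.nwin / winRate μ x ≤ 1 / 2 := by
        rw [div_le_iff₀ hS0]
        linarith
      have h2 := neg_abs_le (Y / p.nwin / winRate μ x - 1)
      have h3 := relErr_le_one 0 (mass μ x)
      simp only [Sampler.ev_output]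
      linarith
    · linarith [ev_ratioEstimate_mul_le hO x hp hS2 (Y / p.nwin)]
  refine (Sampler.ev_mono O _ hpt).trans ?_
  rw [Sampler.ev_add, Sampler.ev_const, Sampler.ev_const_mul]
  linarith [ev_abs_winRate_estimate_le hO x hδ hp.le_nwin hS2]

end MassEstimate

/-! ### The overlap of two distributions -/

section Overlap

/-- A function of the ratio `r` of two masses that vanishes for `r ≤ 1 / 2`. -/
noncomputable def overlapFun (r : ℝ) : ℝ := clamp r * clamp (2 - 3 / (max r (1 / 2) + 1))

theorem overlapFun_nonneg (r : ℝ) : 0 ≤ overlapFun r := mul_nonneg (clamp_nonneg _) (clamp_nonneg _)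

theorem overlapFun_le_one (r : ℝ) : overlapFun r ≤ 1 :=
  mul_le_one₀ (clamp_le_one _) (clamp_nonneg _) (clamp_le_one _)

theorem clamp_of_nonpos {r : ℝ} (h : r ≤ 0) : clamp r = 0 :=
  max_eq_left ((min_le_right _ _).trans h)

theorem clamp_of_one_le {r : ℝ} (h : 1 ≤ r) : clamp r = 1 := by
  rw [clamp_eq_min (by linarith), min_eq_left h]

theorem clamp_of_mem {r : ℝ} (h0 : 0 ≤ r) (h1 : r ≤ 1) : clamp r = r := by
  rw [clamp_eq_min h0, min_eq_right h1]

theorem abs_clamp_sub_clamp_le (r s : ℝ) : |clamp r - clamp s| ≤ |r - s| := by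
  unfold clamp
  rw [max_comm 0, max_comm 0, min_comm 1, min_comm 1]
  refine (abs_max_sub_max_le_abs _ _ _).trans ?_
  have := abs_min_sub_min_le_max r 1 s 1
  simpa using this

theorem overlapFun_of_le {r : ℝ} (h : r ≤ 1 / 2) : overlapFun r = 0 := by
  rw [overlapFun, max_eq_right h, clamp_of_nonpos (r := 2 - 3 / (1 / 2 + 1)) (by norm_num), mul_zero]

theorem overlapFun_of_two_le {r : ℝ} (h : 2 ≤ r) : overlapFun r = 1 := by
  rw [overlapFun, clamp_of_one_le (by linarith), clamp_of_one_le, mul_one]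
  rw [max_eq_left (by linarith)]
  have : 3 / (r + 1) ≤ 1 := by rw [div_le_one (by linarith)]; linarith
  linarith

theorem overlapFun_of_mem {r : ℝ} (h1 : 1 / 2 ≤ r) (h2 : r ≤ 2) :
    overlapFun r = clamp r * ((2 * r - 1) / (r + 1)) := by
  have h : 2 - 3 / (r + 1) = (2 * r - 1) / (r + 1) := by
    have : r + 1 ≠ 0 := by linarith
    field_simp
    ring
  rw [overlapFun, max_eq_left h1, h, clamp_of_mem (r := (2 * r - 1) / (r + 1))]
  · exact div_nonneg (by linarith) (by linarith)
  · rw [div_le_one (by linarith)]; linarith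

/-- Both factors are bounded by 1, with Lipschitz constants 1 and 4/3. The maximum with 1/2 keeps
the second one away from the pole at -1. -/
theorem abs_overlapFun_sub_le (r s : ℝ) : |overlapFun r - overlapFun s| ≤ 3 * |r - s| := by
  have h1 := abs_clamp_sub_clamp_le r s
  set u := max r (1 / 2) with hu
  set v := max s (1 / 2) with hv
  have hu2 : 1 / 2 ≤ u := le_max_right _ _
  have hv2 : 1 / 2 ≤ v := le_max_right _ _
  have huv : |u - v| ≤ |r - s| := abs_max_sub_max_le_abs _ _ _
  have h2 : |clamp (2 - 3 / (u + 1)) - clamp (2 - 3 / (v + 1))| ≤ 4 / 3 * |u - v| := by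
    refine (abs_clamp_sub_clamp_le _ _).trans ?_
    have e : 2 - 3 / (u + 1) - (2 - 3 / (v + 1)) = 3 / ((u + 1) * (v + 1)) * (u - v) := by
      have : u + 1 ≠ 0 := by linarith
      have : v + 1 ≠ 0 := by linarith
      field_simp
      ring
    rw [e, abs_mul]
    have hpos : 0 < (u + 1) * (v + 1) := by nlinarith
    rw [abs_of_pos (div_pos three_pos hpos)]
    refine mul_le_mul_of_nonneg_right ?_ (abs_nonneg _)
    rw [div_le_div_iff₀ hpos three_pos]
    nlinarith
  have e : overlapFun r - overlapFun s
      = (clamp r - clamp s) * clamp (2 - 3 / (u + 1))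
        + clamp s * (clamp (2 - 3 / (u + 1)) - clamp (2 - 3 / (v + 1))) := by
    rw [overlapFun, overlapFun]
    ring
  rw [e]
  refine (abs_add_le _ _).trans ?_
  rw [abs_mul, abs_mul, abs_of_nonneg (clamp_nonneg _), abs_of_nonneg (clamp_nonneg _)]
  have h3 : |clamp r - clamp s| * clamp (2 - 3 / (u + 1)) ≤ |clamp r - clamp s| :=
    mul_le_of_le_one_right (abs_nonneg _) (clamp_le_one _)
  have h4 : clamp s * |clamp (2 - 3 / (u + 1)) - clamp (2 - 3 / (v + 1))|
      ≤ |clamp (2 - 3 / (u + 1)) - clamp (2 - 3 / (v + 1))| :=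
    mul_le_of_le_one_left (abs_nonneg _) (clamp_le_one _)
  linarith [abs_nonneg (r - s)]

theorem abs_overlapFun_sub_le_one (r s : ℝ) : |overlapFun r - overlapFun s| ≤ 1 := by
  rw [abs_le]
  constructor <;> linarith [overlapFun_nonneg r, overlapFun_nonneg s, overlapFun_le_one r,
    overlapFun_le_one s]

/-- For a ≤ b ≤ 2a the two terms are a(2b - a)/(a + b) and a(2a - b)/(a + b), with sum a. Beyond
that range they are a and 0. -/
theorem overlapFun_add_of_le {a b : ℝ} (ha : 0 < a) (hab : a ≤ b) :
    a * overlapFun (b / a) + b * overlapFun (a / b) = a := by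
  have hb : 0 < b := ha.trans_le hab
  rcases le_total (2 * a) b with h | h
  · rw [overlapFun_of_two_le (by rwa [le_div_iff₀ ha]), overlapFun_of_le]
    · ring
    · rw [div_le_iff₀ hb]; linarith
  · rw [overlapFun_of_mem (r := b / a), overlapFun_of_mem (r := a / b), clamp_of_one_le,
      clamp_of_mem (by positivity)]
    · have : a + b ≠ 0 := by linarith
      field_simp
      ring
    · rwa [div_le_one hb]
    · rwa [le_div_iff₀ ha, one_mul]
    · rw [le_div_iff₀ hb]; linarith
    · rw [div_le_iff₀ hb]; linarith
    · rw [le_div_iff₀ ha]; linarith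
    · rwa [div_le_iff₀ ha]

theorem overlapFun_add {a b : ℝ} (ha : 0 ≤ a) (hb : 0 ≤ b) :
    a * overlapFun (b / a) + b * overlapFun (a / b) = min a b := by
  rcases ha.eq_or_lt with rfl | ha
  · simp [overlapFun_of_le, hb]
  rcases hb.eq_or_lt with rfl | hb
  · simp [overlapFun_of_le, ha.le]
  rcases le_total a b with h | h
  · rw [min_eq_left h, overlapFun_add_of_le ha h]
  · rw [min_eq_right h, add_comm, overlapFun_add_of_le hb h]

/-- Turns the absolute Lipschitz bound into a relative one. Large `r` is harmless because
`overlapFun` is constant from 2 on: from `r ≥ 4` it takes `ρ ≤ 1 / 2` to leave that range. -/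
theorem abs_overlapFun_mul_sub_le {r : ℝ} (hr : 0 < r) (ρ : ℝ) :
    |overlapFun (r * ρ) - overlapFun r| ≤ 12 * relErr ρ 1 := by
  have h1 := abs_overlapFun_sub_le_one (r * ρ) r
  rw [relErr, div_one]
  rcases le_total 1 |ρ - 1| with h | h
  · rw [min_eq_left h]
    linarith
  rw [min_eq_right h]
  rcases le_total r 4 with h4 | h4
  · refine (abs_overlapFun_sub_le _ _).trans ?_
    have e : r * ρ - r = r * (ρ - 1) := by ring
    rw [e, abs_mul, abs_of_pos hr]
    nlinarith [abs_nonneg (ρ - 1)]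
  · rcases le_total 2 (r * ρ) with h2 | h2
    · rw [overlapFun_of_two_le h2, overlapFun_of_two_le (by linarith), sub_self, abs_zero]
      positivity
    · have : ρ ≤ 1 / 2 := by nlinarith
      linarith [neg_abs_le (ρ - 1)]

theorem abs_overlapFun_div_sub_le {a b : ℝ} (ha : 0 < a) (hb : 0 ≤ b) (v w : ℝ) :
    |overlapFun (w / v) - overlapFun (b / a)| ≤ 24 * relErr v a + 24 * relErr w b := by
  have h1 := abs_overlapFun_sub_le_one (w / v) (b / a)
  have hv0 := relErr_nonneg v a
  have hw0 := relErr_nonneg w b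
  rcases hb.eq_or_lt with rfl | hb
  -- Division by zero gives 0, so the error relative to a vanishing mass is 1 by convention and the
  -- bound is trivial.
  · have : relErr w 0 = 1 := by simp [relErr]
    linarith
  rcases le_total 1 |v / a - 1| with hv | hv
  · have : relErr v a = 1 := min_eq_left hv
    linarith
  rcases le_total 1 |w / b - 1| with hw | hw
  · have : relErr w b = 1 := min_eq_left hw
    linarith
  have h := abs_overlapFun_mul_sub_le (div_pos hb ha) (w / b / (v / a))
  have e : b / a * (w / b / (v / a)) = w / v := by
    rcases eq_or_ne v 0 with rfl | hv
    · simp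
    · field_simp
  rw [e] at h
  have h2 := relErr_div_le (w / b) (v / a)
  rw [relErr, relErr, min_eq_right hv, min_eq_right hw]
  linarith

open scoped Classical in
-- A false estimate `w = 0` costs nothing where `overlapFun` vanishes. This is why it was made to
-- vanish up to 1/2.
theorem abs_overlapFun_div_sub_le_of_le {a b : ℝ} (ha : 0 < a) (hb : 0 ≤ b) (hab : b / a ≤ 1 / 2)
    (v w : ℝ) : |overlapFun (w / v) - overlapFun (b / a)|
      ≤ 24 * relErr v a + 24 * (if w = 0 then 0 else relErr w b) := by
  split_ifs with h
  · rw [h, zero_div, overlapFun_of_le hab, overlapFun_of_le (by norm_num), sub_self, abs_zero]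
    linarith [relErr_nonneg v a]
  · exact abs_overlapFun_div_sub_le ha hb v w

end Overlap

/-! ### From masses to the distance: bias and averaging -/

section DistanceEstimate

variable {Ω : Type} [Fintype Ω] [DecidableEq Ω] {ι : Type} {O : ι → Oracle Ω} {i j : ι} {μ τ : PMF Ω}

/-- Compare the estimated masses, under both distributions, of a sample from the first one. -/
noncomputable def overlapSample (p : Parameters) (i j : ι) : Sampler ι Ω ℝ :=
  .query i univ fun a => a.elim (.output 0) fun x =>
    (massEstimate p i x).bind fun v => (massEstimate p j x).bind fun w =>
      .output (overlapFun (w / v))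

theorem overlapSample_queriesAtMost (p : Parameters) (i j : ι) :
    (overlapSample p i j : Sampler ι Ω ℝ).QueriesAtMost (2 * p.queries + 1) := by
  intro a
  cases a with
  | none => trivial
  | some x =>
    rw [two_mul]
    exact (massEstimate_queriesAtMost p i x).bind fun v =>
      (massEstimate_queriesAtMost p j x).bind (q' := 0) fun w => trivial

theorem ev_overlapSample_le (p : Parameters) {f : ℝ → ℝ} {c : ℝ}
    (h : ∀ r, 0 ≤ r → r ≤ 1 → f r ≤ c) : (overlapSample p i j : Sampler ι Ω ℝ).ev O f ≤ c := by
  rw [overlapSample, Sampler.ev_query, ← one_mul c, ← Sampler.sum_toReal_pmf (O i univ),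
    Finset.sum_mul]
  refine Finset.sum_le_sum fun a _ => mul_le_mul_of_nonneg_left ?_ ENNReal.toReal_nonneg
  cases a with
  | none => exact h 0 le_rfl zero_le_one
  | some x =>
    simp only [Option.elim, Sampler.ev_bind, Sampler.ev_output]
    exact Sampler.ev_le_of_le O _ fun v => Sampler.ev_le_of_le O _ fun w =>
      h _ (overlapFun_nonneg _) (overlapFun_le_one _)

open scoped Classical in
-- A low win rate under μ is charged to the mass under μ. If only the win rate under τ is low, a
-- ratio up to 1/2 tolerates the estimate 0, and a larger ratio means μ(x) < 2τ(x), which is charged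
-- to the last term. Otherwise both estimates are accurate, with error 24 · 7δ each.
theorem mass_mul_ev_overlapFun_le (hμ : IsConditionalOracle μ (O i))
    (hτ : IsConditionalOracle τ (O j)) {p : Parameters} (hp : p.Suitable (Fintype.card Ω)) (x : Ω) :
    mass μ x * (massEstimate p i x).ev O (fun v => (massEstimate p j x).ev O fun w =>
        |overlapFun (w / v) - overlapFun (mass τ x / mass μ x)|)
      ≤ 336 * p.δ * mass μ x + (if winRate μ x < 2 * p.δ then mass μ x else 0)
        + 2 * (if winRate τ x < 2 * p.δ then mass τ x else 0) := by
  have hδ := hp.pos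
  have hm0 := mass_nonneg μ x
  have ht0 := mass_nonneg τ x
  have hle1 : (massEstimate p i x).ev O (fun v => (massEstimate p j x).ev O fun w =>
        |overlapFun (w / v) - overlapFun (mass τ x / mass μ x)|) ≤ 1 :=
    Sampler.ev_le_of_le O _ fun v => Sampler.ev_le_of_le O _ fun w => abs_overlapFun_sub_le_one _ _
  have hle1' := mul_le_mul_of_nonneg_left hle1 hm0
  have h336 : 0 ≤ 336 * p.δ * mass μ x := by positivity
  have htau : 0 ≤ (if winRate τ x < 2 * p.δ then mass τ x else 0) := by split_ifs <;> simp [ht0]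
  rcases hm0.eq_or_lt with hm | hm
  · simp only [← hm, zero_mul, mul_zero, ite_self, zero_add]
    linarith
  rcases lt_or_ge (winRate μ x) (2 * p.δ) with hS | hS
  · rw [if_pos hS]
    linarith
  rw [if_neg hS.not_gt]
  have hmu := ev_massEstimate_le hμ hp hS
  have key : ∀ g : ℝ → ℝ, (massEstimate p j x).ev O g ≤ 7 * p.δ →
      (∀ v w, |overlapFun (w / v) - overlapFun (mass τ x / mass μ x)|
        ≤ 24 * relErr v (mass μ x) + 24 * g w) →
      (massEstimate p i x).ev O (fun v => (massEstimate p j x).ev O fun w =>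
        |overlapFun (w / v) - overlapFun (mass τ x / mass μ x)|) ≤ 336 * p.δ := by
    intro g hg hpt
    have h1 : ∀ v, (massEstimate p j x).ev O
        (fun w => |overlapFun (w / v) - overlapFun (mass τ x / mass μ x)|)
        ≤ 24 * relErr v (mass μ x) + 24 * (massEstimate p j x).ev O g := by
      intro v
      refine (Sampler.ev_mono O _ (hpt v)).trans ?_
      rw [Sampler.ev_add, Sampler.ev_const, Sampler.ev_const_mul]
    refine (Sampler.ev_mono O _ h1).trans ?_
    rw [Sampler.ev_add, Sampler.ev_const, Sampler.ev_const_mul]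
    linarith
  rcases lt_or_ge (winRate τ x) (2 * p.δ) with hT | hT
  · rw [if_pos hT]
    rcases le_or_gt (mass τ x / mass μ x) (1 / 2) with hr | hr
    · have h1 := key _ ((ev_massEstimate_or_zero_le hτ x hp).trans (by linarith))
        (abs_overlapFun_div_sub_le_of_le hm ht0 hr)
      have := mul_le_mul_of_nonneg_left h1 hm0
      linarith
    · rw [lt_div_iff₀ hm] at hr
      linarith
  · rw [if_neg hT.not_gt]
    have h1 := key _ (ev_massEstimate_le hτ hp hT) (abs_overlapFun_div_sub_le hm ht0)
    have := mul_le_mul_of_nonneg_left h1 hm0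
    linarith

/-- The elements with win rate below 2δ have mass at most 4δ under each distribution: 348 = 336 + 4
+ 2 · 4. -/
theorem abs_ev_overlapSample_sub_le (hμ : IsConditionalOracle μ (O i))
    (hτ : IsConditionalOracle τ (O j)) {p : Parameters} (hp : p.Suitable (Fintype.card Ω)) :
    |(overlapSample p i j).ev O (fun r => r)
      - ∑ x, mass μ x * overlapFun (mass τ x / mass μ x)| ≤ 348 * p.δ := by
  classical
  have hone : massOn μ (univ : Finset Ω) = 1 := sum_mass μ
  rw [overlapSample, ev_query_eq hμ (by rw [hone]; exact one_pos), hone, ← Finset.sum_sub_distrib]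
  refine (Finset.abs_sum_le_sum_abs _ _).trans ?_
  have hx : ∀ x ∈ (univ : Finset Ω), |mass μ x / 1 * ((some x).elim (.output 0) fun x =>
      (massEstimate p i x).bind fun v => (massEstimate p j x).bind fun w =>
        .output (overlapFun (w / v)) : Sampler ι Ω ℝ).ev O (fun r => r)
        - mass μ x * overlapFun (mass τ x / mass μ x)|
      ≤ 336 * p.δ * mass μ x + (if winRate μ x < 2 * p.δ then mass μ x else 0)
        + 2 * (if winRate τ x < 2 * p.δ then mass τ x else 0) := by
    intro x _
    refine le_trans ?_ (mass_mul_ev_overlapFun_le hμ hτ hp x)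
    simp only [Option.elim, Sampler.ev_bind, Sampler.ev_output]
    rw [div_one, ← mul_sub, abs_mul, abs_of_nonneg (mass_nonneg μ x)]
    refine mul_le_mul_of_nonneg_left ?_ (mass_nonneg μ x)
    refine (Sampler.abs_ev_sub_le O _ _ _).trans (Sampler.ev_mono O _ fun v => ?_)
    exact Sampler.abs_ev_sub_le O _ _ _
  refine (Finset.sum_le_sum hx).trans ?_
  rw [Finset.sum_add_distrib, Finset.sum_add_distrib, ← Finset.mul_sum, ← Finset.mul_sum, sum_mass]
  have h1 := sum_mass_winRate_lt_le μ (2 * p.δ) (by linarith [hp.pos])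
  have h2 := sum_mass_winRate_lt_le τ (2 * p.δ) (by linarith [hp.pos])
  linarith

theorem dTV_eq_one_sub (μ τ : PMF Ω) : dTV μ τ = 1 - ∑ x, min (mass μ x) (mass τ x) := by
  have h : ∀ x, |(μ x).toReal - (τ x).toReal|
      = mass μ x + mass τ x - 2 * min (mass μ x) (mass τ x) := by
    intro x
    change |mass μ x - mass τ x| = _
    rcases le_total (mass μ x) (mass τ x) with h | h
    · rw [min_eq_left h, abs_of_nonpos (by linarith)]; ring
    · rw [min_eq_right h, abs_of_nonneg (by linarith)]; ring
  rw [dTV, Finset.sum_congr rfl fun x _ => h x, Finset.sum_sub_distrib, Finset.sum_add_distrib,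
    sum_mass, sum_mass, ← Finset.mul_sum]
  ring

/-- One sample whose expectation is close to the overlap of the two distributions. -/
noncomputable def overlapPair (p : Parameters) : Sampler (Fin 2) Ω ℝ :=
  (overlapSample p 0 1).bind fun r => (overlapSample p 1 0).bind fun s => .output (r + s)

theorem overlapPair_queriesAtMost (p : Parameters) :
    (overlapPair p : Sampler (Fin 2) Ω ℝ).QueriesAtMost (4 * p.queries + 2) := by
  rw [show 4 * p.queries + 2 = 2 * p.queries + 1 + (2 * p.queries + 1 + 0) by ring]
  exact (overlapSample_queriesAtMost p 0 1).bind fun r =>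
    (overlapSample_queriesAtMost p 1 0).bind fun s => trivial

theorem abs_ev_overlapPair_sub_le {O : Fin 2 → Oracle Ω} (hμ : IsConditionalOracle μ (O 0))
    (hτ : IsConditionalOracle τ (O 1)) {p : Parameters} (hp : p.Suitable (Fintype.card Ω)) :
    |(overlapPair p).ev O (fun r => r) - (1 - dTV μ τ)| ≤ 696 * p.δ := by
  have h1 := abs_ev_overlapSample_sub_le hμ hτ hp
  have h2 := abs_ev_overlapSample_sub_le hτ hμ hp
  have e1 : (overlapPair p).ev O (fun r => r)
      = (overlapSample p 0 1).ev O (fun r => r) + (overlapSample p 1 0).ev O (fun r => r) := by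
    simp only [overlapPair, Sampler.ev_bind, Sampler.ev_output]
    have h : ∀ r : ℝ, (overlapSample p 1 0 : Sampler (Fin 2) Ω ℝ).ev O (fun s => r + s)
        = r + (overlapSample p 1 0).ev O (fun s => s) := fun r => by
      rw [Sampler.ev_add O _ (fun _ => r), Sampler.ev_const]
    simp only [h]
    rw [Sampler.ev_add O _ (fun r => r), Sampler.ev_const]
  have e2 : 1 - dTV μ τ = ∑ x, mass μ x * overlapFun (mass τ x / mass μ x)
      + ∑ x, mass τ x * overlapFun (mass μ x / mass τ x) := by
    rw [dTV_eq_one_sub, sub_sub_cancel, ← Finset.sum_add_distrib]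
    exact Finset.sum_congr rfl fun x _ => (overlapFun_add (mass_nonneg μ x) (mass_nonneg τ x)).symm
  rw [e1, e2]
  rw [abs_le] at h1 h2 ⊢
  constructor <;> linarith

/-- An estimate of the total variation distance from `K` samples of `overlapPair`. -/
noncomputable def distanceEstimate (p : Parameters) (K : ℕ) : Sampler (Fin 2) Ω ℝ :=
  ((overlapPair p).iterSum K).bind fun r => .output (1 - r / K)

theorem distanceEstimate_queriesAtMost (p : Parameters) (K : ℕ) :
    (distanceEstimate p K : Sampler (Fin 2) Ω ℝ).QueriesAtMost (K * (4 * p.queries + 2)) :=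
  ((overlapPair_queriesAtMost p).iterSum K).bind (q' := 0) fun _ => trivial

open scoped Classical in
-- The bias is at most 696δ ≤ ε/2. A sample lies in [0,2], so the average has variance at most 4/K,
-- and Chebyshev bounds a deviation above ε/2 by 16/(ε²K) ≤ 1/3.
theorem ev_distanceEstimate_ge {O : Fin 2 → Oracle Ω} (hμ : IsConditionalOracle μ (O 0))
    (hτ : IsConditionalOracle τ (O 1)) {p : Parameters} (hp : p.Suitable (Fintype.card Ω))
    {ε : ℝ} (hε : 0 < ε) (hδ : 1392 * p.δ ≤ ε) {K : ℕ} (hK : 48 / ε ^ 2 ≤ K) :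
    2 / 3 ≤ (distanceEstimate p K).ev O (fun r => if |r - dTV μ τ| ≤ ε then 1 else 0) := by
  have hK' : (0 : ℝ) < K := lt_of_lt_of_le (by positivity) hK
  have hθ := abs_ev_overlapPair_sub_le hμ hτ hp
  set θ := (overlapPair p).ev O (fun r => r) with hθdef
  have hsq : (overlapPair p).ev O (fun r => r ^ 2) ≤ 4 := by
    simp only [overlapPair, Sampler.ev_bind, Sampler.ev_output]
    exact ev_overlapSample_le p fun r hr0 hr1 => ev_overlapSample_le p fun s hs0 hs1 => by nlinarith
  have hvar := Sampler.ev_iterSum_sq O (overlapPair p) hθdef.symm rfl K (K * θ)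
  have hvar' : ((overlapPair p).iterSum K).ev O (fun r => (r - K * θ) ^ 2) ≤ 4 * K := by
    rw [hvar]
    nlinarith [mul_nonneg hK'.le (sq_nonneg θ)]
  simp only [distanceEstimate, Sampler.ev_bind, Sampler.ev_output]
  have hpt : ∀ r : ℝ, -(4 / (ε ^ 2 * K ^ 2)) * (r - K * θ) ^ 2 + 1
      ≤ if |1 - r / K - dTV μ τ| ≤ ε then 1 else 0 := by
    intro r
    split_ifs with h
    · have : 0 ≤ 4 / (ε ^ 2 * K ^ 2) * (r - K * θ) ^ 2 := by positivity
      linarith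
    · push Not at h
      have h1 : ε / 2 < |r / K - θ| := by
        have h2 : 1 - r / K - dTV μ τ = -(r / K - θ) - (θ - (1 - dTV μ τ)) := by ring
        rw [h2] at h
        have h3 := abs_sub (-(r / K - θ)) (θ - (1 - dTV μ τ))
        rw [abs_neg] at h3
        linarith
      have h4 : (ε / 2) ^ 2 ≤ (r / K - θ) ^ 2 := by
        rw [← sq_abs (r / K - θ)]
        gcongr
      have e : 4 / (ε ^ 2 * K ^ 2) * (r - K * θ) ^ 2 = (r / K - θ) ^ 2 / (ε / 2) ^ 2 := by
        field_simp
        ring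
      have h5 : 1 ≤ (r / K - θ) ^ 2 / (ε / 2) ^ 2 := by
        rw [le_div_iff₀ (by positivity)]
        linarith
      linarith
  refine le_trans ?_ (Sampler.ev_mono O _ hpt)
  rw [Sampler.ev_add, Sampler.ev_const, Sampler.ev_const_mul]
  have h6 := mul_le_mul_of_nonneg_left hvar' (by positivity : 0 ≤ 4 / (ε ^ 2 * (K : ℝ) ^ 2))
  have h7 : 4 / (ε ^ 2 * (K : ℝ) ^ 2) * (4 * K) ≤ 1 / 3 := by
    calc _ = 16 / (ε ^ 2 * K) := by field_simp; norm_num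
      _ ≤ 16 / (ε ^ 2 * (48 / ε ^ 2)) := by gcongr
      _ = _ := by field_simp; norm_num
  linarith

theorem estimatesDTV_distanceEstimate {N : ℕ} {p : Parameters} (hp : p.Suitable N)
    {ε : ℝ} (hε : 0 < ε) (hδ : 1392 * p.δ ≤ ε) {K : ℕ} (hK : 48 / ε ^ 2 ≤ K) :
    EstimatesDTV ε (distanceEstimate p K : Sampler (Fin 2) (Fin N) ℝ).toAlgorithm := by
  intro μ τ Oμ Oτ hμ hτ
  classical
  rw [Sampler.prob_run_toAlgorithm]
  have h := ev_distanceEstimate_ge (O := ![Oμ, Oτ]) hμ hτ (p := p) (by simpa using hp) hε hδ hK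
  have e : (2 / 3 : ENNReal) = ENNReal.ofReal (2 / 3) := by
    rw [ENNReal.ofReal_div_of_pos three_pos]
    norm_num
  rw [e]
  refine ENNReal.ofReal_le_ofReal (h.trans_eq ?_)
  simp only [Set.mem_ofPred_eq]

end DistanceEstimate
end CondSampling

/-! ### Choice of the parameters and the query count -/

namespace CondSampling

/-- The dependence on δ is kept crude on purpose: only the logarithm of M enters the query count,
where 1/δ⁵ absorbs it. -/
theorem exists_search_size {N : ℕ} (hN : 1 ≤ N) {δ : ℝ} (hδ : 0 < δ) (hδ1 : δ ≤ 1) :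
    ∃ M : ℕ, 1 ≤ M ∧ 100 * N * scale M ≤ δ ∧
      (M + 1 : ℝ) ≤ max 1 (Real.log N) * (405 / δ) := by
  have hN1 : (1 : ℝ) ≤ N := by exact_mod_cast hN
  have hδ1' : 1 ≤ 1 / δ := by rwa [le_div_iff₀ hδ, one_mul]
  set n := ⌈100 * N / δ⌉₊ with hn
  have hbig : 100 ≤ 100 * N / δ := by rw [le_div_iff₀ hδ]; nlinarith
  have hn1 : 100 * N / δ ≤ n := Nat.le_ceil _
  have hn2 : (n : ℝ) ≤ 200 * N / δ := by
    have := (Nat.ceil_lt_add_one (by linarith : 0 ≤ 100 * N / δ)).le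
    have e : 200 * N / δ = 100 * N / δ + 100 * N / δ := by ring
    linarith
  refine ⟨Nat.clog 2 n + 1, by omega, ?_, ?_⟩
  · have h : (n : ℝ) ≤ 2 ^ Nat.clog 2 n := by exact_mod_cast Nat.le_pow_clog one_lt_two n
    rw [scale, Nat.add_sub_cancel, one_div, inv_pow, ← div_eq_mul_inv, div_le_iff₀ (by positivity)]
    have := hn1.trans h
    rw [div_le_iff₀ hδ] at this
    linarith
  · have hn3 : 1 < n := by
      have : (1 : ℝ) < n := by linarith
      exact_mod_cast this
    have h : (2 : ℝ) ^ (Nat.clog 2 n).pred < n := by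
      exact_mod_cast Nat.pow_pred_clog_lt_self one_lt_two hn3
    have hc : (Nat.clog 2 n : ℝ) ≤ (Nat.clog 2 n).pred + 1 := by
      have := Nat.le_succ_of_pred_le (le_refl (Nat.clog 2 n).pred)
      exact_mod_cast this
    have hlog : ((Nat.clog 2 n).pred : ℝ) * Real.log 2 ≤ Real.log n := by
      rw [← Real.log_pow]
      exact Real.log_le_log (by positivity) h.le
    have hlogn : Real.log n ≤ Real.log N + 200 / δ := by
      calc Real.log n ≤ Real.log (N * (200 / δ)) :=
            Real.log_le_log (by positivity) (hn2.trans_eq (by ring))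
        _ = Real.log N + Real.log (200 / δ) := Real.log_mul (by positivity) (by positivity)
        _ ≤ _ := by
            have := Real.log_le_sub_one_of_pos (by positivity : 0 < 200 / δ)
            linarith
    have hlog2 := Real.log_two_gt_d9
    have hpred : ((Nat.clog 2 n).pred : ℝ) ≤ 2 * Real.log n := by
      have : (0 : ℝ) ≤ (Nat.clog 2 n).pred := Nat.cast_nonneg _
      nlinarith
    have hm1 : 1 ≤ max 1 (Real.log N) := le_max_left _ _
    have hm2 : Real.log N ≤ max 1 (Real.log N) := le_max_right _ _
    have e1 : 405 / δ = 405 * (1 / δ) := by ring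
    have e2 : 200 / δ = 200 * (1 / δ) := by ring
    push_cast
    rw [e1]
    rw [e2] at hlogn
    nlinarith

/-- Since 91/100 ≤ exp(-9/100) and 12 · 9/100 > 1, twelve times the logarithm is enough. -/
theorem exists_search_length {M : ℕ} {δ : ℝ} (hδ : 0 < δ) (hδ1 : δ ≤ 1) :
    ∃ R : ℕ, (M + 1 : ℝ) * (91 / 100) ^ R ≤ δ ∧ (R : ℝ) ≤ 12 * Real.log ((M + 1) / δ) + 1 := by
  have hpos : 0 < (M + 1 : ℝ) / δ := by positivity
  have hlog : 0 ≤ Real.log ((M + 1) / δ) := by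
    refine Real.log_nonneg ?_
    rw [le_div_iff₀ hδ]
    have : (0 : ℝ) ≤ M := Nat.cast_nonneg M
    linarith
  refine ⟨⌈12 * Real.log ((M + 1) / δ)⌉₊, ?_, (Nat.ceil_lt_add_one (by positivity)).le⟩
  set R := ⌈12 * Real.log ((M + 1) / δ)⌉₊
  have hR : 12 * Real.log ((M + 1) / δ) ≤ R := Nat.le_ceil _
  have h1 : (91 / 100 : ℝ) ^ R ≤ Real.exp (-Real.log ((M + 1) / δ)) := by
    calc (91 / 100 : ℝ) ^ R ≤ Real.exp (-(9 / 100)) ^ R := by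
          gcongr
          have := Real.add_one_le_exp (-(9 / 100))
          linarith
      _ = Real.exp (R * -(9 / 100)) := (Real.exp_nat_mul _ _).symm
      _ ≤ _ := Real.exp_le_exp.2 (by linarith)
  rw [Real.exp_neg, Real.exp_log hpos] at h1
  calc (M + 1 : ℝ) * (91 / 100) ^ R ≤ (M + 1) * ((M + 1) / δ)⁻¹ := by gcongr
    _ = δ := by field_simp

theorem log_max_one_log (x : ℝ) :
    Real.log (max 1 (Real.log x)) ≤ max 0 (Real.log (Real.log x)) := by
  rcases le_total 1 (Real.log x) with h | h
  · rw [max_eq_right h]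
    exact le_max_right _ _
  · rw [max_eq_left h, Real.log_one]
    exact le_max_left _ _

theorem exists_parameters : ∃ C : ℝ, 0 < C ∧ ∀ (N : ℕ) (δ : ℝ), 1 ≤ N → 0 < δ → δ ≤ 1 →
    ∃ p : Parameters, p.δ = δ ∧ p.Suitable N ∧
      (p.queries : ℝ) ≤ 24 * max 0 (Real.log (Real.log N)) + C / δ ^ 5 := by
  refine ⟨6 + 24 * 405 + 2 + 3 * 5898240001 + 3 * 9217, by norm_num, fun N δ hN hδ hδ1 => ?_⟩
  obtain ⟨M, hM1, hM, hMle⟩ := exists_search_size hN hδ hδ1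
  obtain ⟨R, hR, hRle⟩ := exists_search_length (M := M) hδ hδ1
  refine ⟨⟨δ, ⌈2 / δ ^ 3⌉₊, M, R, ⌈5898240000 / δ ^ 4⌉₊, ⌈9216 / δ ^ 5⌉₊⟩, rfl,
    ⟨hδ, hδ1, Nat.le_ceil _, hM1, hM, hR, Nat.le_ceil _, Nat.le_ceil _⟩, ?_⟩
  have hpow : ∀ k ≤ 5, 1 / δ ^ k ≤ 1 / δ ^ 5 := fun k hk =>
    one_div_le_one_div_of_le (by positivity) (pow_le_pow_of_le_one hδ.le hδ1 hk)
  have h0 := hpow 0 (by norm_num)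
  have h2 := hpow 2 (by norm_num)
  have h3 := hpow 3 (by norm_num)
  have h4 := hpow 4 (by norm_num)
  rw [pow_zero, div_one] at h0
  have c1 : (⌈2 / δ ^ 3⌉₊ : ℝ) ≤ 2 * (1 / δ ^ 3) + 1 := by
    rw [← div_eq_mul_one_div]
    exact (Nat.ceil_lt_add_one (by positivity)).le
  have c2 : (⌈5898240000 / δ ^ 4⌉₊ : ℝ) ≤ 5898240000 * (1 / δ ^ 4) + 1 := by
    rw [← div_eq_mul_one_div]
    exact (Nat.ceil_lt_add_one (by positivity)).le
  have c3 : (⌈9216 / δ ^ 5⌉₊ : ℝ) ≤ 9216 * (1 / δ ^ 5) + 1 := by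
    rw [← div_eq_mul_one_div]
    exact (Nat.ceil_lt_add_one (by positivity)).le
  have hlog : Real.log ((M + 1) / δ) ≤ max 0 (Real.log (Real.log N)) + 405 / δ ^ 2 := by
    have hm : 0 < max 1 (Real.log N) := lt_of_lt_of_le one_pos (le_max_left _ _)
    calc Real.log ((M + 1) / δ) ≤ Real.log (max 1 (Real.log N) * (405 / δ ^ 2)) := by
          refine Real.log_le_log (by positivity) ?_
          calc (M + 1 : ℝ) / δ ≤ max 1 (Real.log N) * (405 / δ) / δ := by gcongr
            _ = _ := by field_simp
      _ = Real.log (max 1 (Real.log N)) + Real.log (405 / δ ^ 2) :=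
          Real.log_mul hm.ne' (by positivity)
      _ ≤ _ := by
          have := Real.log_le_sub_one_of_pos (by positivity : 0 < 405 / δ ^ 2)
          linarith [log_max_one_log (N : ℝ)]
  rw [div_eq_mul_one_div 405] at hlog
  simp only [Parameters.queries]
  push_cast
  rw [div_eq_mul_one_div (6 + 24 * 405 + 2 + 3 * 5898240001 + 3 * 9217) (δ ^ 5)]
  linarith

theorem dTV_mem_Icc {Ω : Type} [Fintype Ω] (μ τ : PMF Ω) : 0 ≤ dTV μ τ ∧ dTV μ τ ≤ 1 := by
  classical
  constructor
  · exact mul_nonneg (by norm_num) (Finset.sum_nonneg fun x _ => abs_nonneg _)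
  · rw [dTV_eq_one_sub]
    have : 0 ≤ ∑ x, min (mass μ x) (mass τ x) :=
      Finset.sum_nonneg fun x _ => le_min (mass_nonneg μ x) (mass_nonneg τ x)
    linarith

theorem estimatesDTV_output_zero {Ω : Type} [Fintype Ω] {ε : ℝ} (hε : 1 ≤ ε) :
    EstimatesDTV ε (Algorithm.output 0 : Algorithm (Fin 2) Ω ℝ) := by
  classical
  intro μ τ Oμ Oτ _ _
  have h := dTV_mem_Icc μ τ
  rw [prob, Algorithm.run, PMF.toOuterMeasure_pure_apply, if_pos]
  · exact ENNReal.div_le_of_le_mul (by norm_num)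
  · change |0 - dTV μ τ| ≤ ε
    rw [zero_sub, abs_neg, abs_of_nonneg h.1]
    linarith

end CondSampling

theorem theorem1p4 :
    ∃ (C : ℝ) (k : ℕ), 0 < C ∧
      ∀ (N : ℕ) (ε : ℝ), 1 ≤ N → 0 < ε →
        ∃ (alg : CondSampling.Algorithm (Fin 2) (Fin N) ℝ) (q : ℕ),
          CondSampling.EstimatesDTV ε alg ∧
          alg.QueriesAtMost q ∧
          (q : ℝ) ≤ C * (max 0 (Real.log (Real.log (N : ℝ))) / ε ^ 2 + 1 / ε ^ 7)
            * (1 + |Real.log (1 / ε)|) ^ k := by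
  obtain ⟨C, hC, hparam⟩ := CondSampling.exists_parameters
  -- The exponent of the logarithmic factor can be 0. For ε ≥ 1 the constant output 0 is good
  -- enough, as the distance is at most 1.
  refine ⟨49 * (96 + 4 * C * 1392 ^ 5 + 2), 0, by positivity, fun N ε hN hε => ?_⟩
  rcases le_or_gt 1 ε with hε1 | hε1
  · refine ⟨.output 0, 0, CondSampling.estimatesDTV_output_zero hε1, ?_, ?_⟩
    · simp [CondSampling.Algorithm.QueriesAtMost]
    · rw [Nat.cast_zero]
      positivity
  obtain ⟨p, hpδ, hp, hq⟩ := hparam N (ε / 1392) hN (by positivity) (by linarith)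
  set K := ⌈48 / ε ^ 2⌉₊ with hK
  refine ⟨(CondSampling.distanceEstimate p K).toAlgorithm, K * (4 * p.queries + 2),
    CondSampling.estimatesDTV_distanceEstimate hp hε (by rw [hpδ]; linarith) (Nat.le_ceil _),
    (CondSampling.distanceEstimate_queriesAtMost p K).toAlgorithm, ?_⟩
  set L := max 0 (Real.log (Real.log (N : ℝ)))
  have hL : 0 ≤ L := le_max_left _ _
  have h1 : 1 ≤ 1 / ε ^ 2 := by
    rw [le_div_iff₀ (by positivity), one_mul]
    exact pow_le_one₀ hε.le hε1.le
  have h5 : 1 ≤ 1 / ε ^ 5 := by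
    rw [le_div_iff₀ (by positivity), one_mul]
    exact pow_le_one₀ hε.le hε1.le
  have hKle : (K : ℝ) ≤ 49 * (1 / ε ^ 2) := by
    have := (Nat.ceil_lt_add_one (by positivity : 0 ≤ 48 / ε ^ 2)).le
    have e : 48 / ε ^ 2 = 48 * (1 / ε ^ 2) := div_eq_mul_one_div _ _
    linarith
  have hqle : (4 * p.queries + 2 : ℝ) ≤ 96 * L + (4 * C * 1392 ^ 5 + 2) * (1 / ε ^ 5) := by
    have e : C / (ε / 1392) ^ 5 = C * 1392 ^ 5 * (1 / ε ^ 5) := by field_simp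
    rw [e] at hq
    linarith
  rw [pow_zero, mul_one]
  push_cast
  calc (K : ℝ) * (4 * p.queries + 2)
      ≤ 49 * (1 / ε ^ 2) * (96 * L + (4 * C * 1392 ^ 5 + 2) * (1 / ε ^ 5)) := by gcongr
    _ = 49 * (96 * (L / ε ^ 2) + (4 * C * 1392 ^ 5 + 2) * (1 / ε ^ 7)) := by field_simp
    _ ≤ 49 * ((96 + 4 * C * 1392 ^ 5 + 2) * (L / ε ^ 2)
          + (96 + 4 * C * 1392 ^ 5 + 2) * (1 / ε ^ 7)) := by
        gcongr
        · have : 0 ≤ 4 * C * 1392 ^ 5 := by positivity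
          linarith
        · linarith
    _ = _ := by ring
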